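/- Let $\varepsilon_1,\varepsilon_2,\dots$ be independent random variables with $\mathbb P\{\varepsilon_j=0\}=\mathbb P\{\varepsilon_j=1\}=\tfrac12$, and let $B_n=\varepsilon_1+\dots+\varepsilon_n$ ($B_0=0$). Put $\delta_0=\Delta_0=0$ and, for integers $\ell,k\ge 1$, $$\delta_\ell=\inf\{n\ge 1:\ \varepsilon_{n+\delta_1+\dots+\delta_{\ell-1}}=1\},\qquad \Delta_k=\delta_1+\dots+\delta_k .$$ With probability one, all the sets in this definition are nonempty, so that all $\delta_\ell$ and $\Delta_k$ are finite. Write $\binom ab$ for the binomial coefficient, which is $0$ if $b>a$. (i) The random variables $\delta_\ell$, $\ell\ge1$, are i.i.d. and geometrically distributed: $\mathbb P\{\delta_\ell=m\}=2^{-m}$ for all $\ell\ge1$, $m\ge1$. (ii) $\delta_1$ is square integrable, $\mathbb E\,\delta_1=2$ and $\mathrm{Var}(\delta_1)=2$. Further, for all real $t$ and all $k\ge1$, $$\mathbb E\,e^{2i\pi\delta_1t}=\sum_{m=1}^\infty\frac{e^{2i\pi mt}}{2^m},\qquad \mathbb E\,e^{2i\pi\Delta_kt}=\sum_{\nu=1}^\infty\frac{e^{2i\pi\nu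 t}}{2^\nu}\binom{\nu-1}{k-1}.$$ (iii) For all $k\ge1$, $m\ge1$, $$\mathbb P\{\Delta_k=m\}=\frac{1}{2^m}\binom{m-1}{k-1}=\tfrac12\,\mathbb P\{B_{m-1}=k-1\}.$$ (iv) With probability one, $$\limsup_{k\to\infty}\frac{\delta_k}{\log_2 k}=1,\qquad \limsup_{k\to\infty}\frac{\Delta_k-2k}{2\sqrt{k\log\log k}}=1,$$ where $\log_2$ is the logarithm to base $2$ and $\log$ the natural logarithm. (v) $\dfrac{\Delta_k-2k}{\sqrt{2k}}$ converges in distribution to $\mathcal N(0,1)$ as $k\to\infty$, and there is a constant $C$ such that for all $k\ge 1$ $$\sup_{n\in\mathbb Z}\Big|\sqrt k\,\mathbb P\{\Delta_k=n\}-\frac1{2\sqrt\pi}\,e^{-\frac{(n-2k)^2}{4k}}\Big|\le \frac{C}{\sqrt k}.$$ -/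

import Mathlib

open MeasureTheory ProbabilityTheory Filter Topology

/-- A fair Bernoulli sequence `ε₁, ε₂, …` on `(Ω, P)`: independent random variables, each taking
the values `0` and `1` with probability `1/2`. Only the indices `j ≥ 1` matter. -/
structure IsFairBernoulliSeq {Ω : Type*} [MeasurableSpace Ω] (ε : ℕ → Ω → ℕ) (P : Measure Ω) :
    Prop where
  measurable : ∀ j : ℕ, 1 ≤ j → Measurable (ε j)
  indep : iIndepFun (fun j : ℕ => ε (j + 1)) P
  prob_one : ∀ j : ℕ, 1 ≤ j → P.real {ω | ε j ω = 1} = 1 / 2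
  prob_zero : ∀ j : ℕ, 1 ≤ j → P.real {ω | ε j ω = 0} = 1 / 2

/-- The Bernoulli sums `B_n = ε₁ + … + ε_n` (so `B₀ = 0`). -/
def bernoulliSum {Ω : Type*} (ε : ℕ → Ω → ℕ) (n : ℕ) (ω : Ω) : ℕ :=
  ∑ j ∈ Finset.Icc 1 n, ε j ω

/-- The gaps between successes: `δ₀ = 0` and
`δ_ℓ = inf {n ≥ 1 : ε_{n + δ₁ + … + δ_{ℓ-1}} = 1}` for `ℓ ≥ 1`.
The infimum is taken in `ℕ`; it is attained at every `ℓ` outside of a null event. -/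
noncomputable def gap {Ω : Type*} (ε : ℕ → Ω → ℕ) : ℕ → Ω → ℕ
  | 0, _ => 0
  | ℓ + 1, ω => sInf {n : ℕ | 1 ≤ n ∧ ε (n + ∑ i : Fin ℓ, gap ε (i.val + 1) ω) ω = 1}
termination_by ℓ => ℓ
decreasing_by have := i.isLt; omega

/-- The instants of jump `Δ_k = δ₁ + … + δ_k` (so `Δ₀ = 0`). -/
noncomputable def jumpTime {Ω : Type*} (ε : ℕ → Ω → ℕ) (k : ℕ) (ω : Ω) : ℕ :=
  ∑ ℓ ∈ Finset.Icc 1 k, gap ε ℓ ω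

theorem gap_zero {Ω : Type*} (ε : ℕ → Ω → ℕ) (ω : Ω) : gap ε 0 ω = 0 := by
  rw [gap]

theorem gap_succ {Ω : Type*} (ε : ℕ → Ω → ℕ) (ℓ : ℕ) (ω : Ω) :
    gap ε (ℓ + 1) ω = sInf {n : ℕ | 1 ≤ n ∧ ε (n + jumpTime ε ℓ ω) ω = 1} := by
  have h : jumpTime ε ℓ ω = ∑ i : Fin ℓ, gap ε (i.val + 1) ω := by
    rw [jumpTime, Fin.sum_univ_eq_sum_range (fun i => gap ε (i + 1) ω) ℓ,
      Finset.range_eq_Ico, Finset.sum_Ico_add' (fun i => gap ε i ω) 0 ℓ 1]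
    rfl
  rw [h, gap]

/-! Prescribing positive values `m₁, …, m_k` for the first `k` gaps is the same as prescribing the
first `m₁ + … + m_k` bits: each gap is a run of zeros closed by a one (`exists_pattern`). Such a
word has probability `2^{-(m₁+…+m_k)}`, a product, so the gaps are independent and geometric
(`map_gap_fin`, `isGeometricSeq_gap`). From there on only `IsGeometricSeq` is used for the gaps.
Moments and generating functions come from geometric series, and the law of `Δ_k` from convolution
and the hockey-stick identity.

The local limit theorem is Fourier inversion. The centred characteristic function is `φ(t) = 1 / (1
- (e^{it} - 1)²)`. On `[-π, π]` it satisfies `|φ(t)| ≤ e^{-t²/25}` and `φ(t) = e^{-t²} + O(|t|³)`;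
hence `φ^k - e^{-kt²}` is `O(k |t|³ e^{-kt²/25})`, whose integral is `O(1/k)`. Multiplying by `√k`
gives the rate. The central limit theorem is the standard one applied to standardized gaps.

The growth of `δ_k` follows from both Borel-Cantelli lemmas and the exact tail `2^{-n}`. For the
upper half of the iterated logarithm, Doob's inequality for exponentials of the partial sums
(`real_exists_le_sum_le`) is applied up to times `ρ^{j+1}`. For the lower half, summing the local
limit theorem over about `√k` integers gives a Gaussian lower bound for tails
(`exists_tail_lower_bound`). It is applied to the independent blocks between `(j!)²` and
`((j+1)!)²`. These grow so fast that each block dominates its past by mere Chebyshev and that the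
error `C/√k` is negligible against `1/j`. -/

/-! ### Borel-Cantelli lemmas -/

/-- Second Borel-Cantelli lemma for events that depend on separate independent variables. -/
theorem ae_frequently_mem_of_not_summable {Ω β : Type*} [MeasurableSpace Ω] [MeasurableSpace β]
    {P : Measure Ω} {X : ℕ → Ω → β} (hX : ∀ i, Measurable (X i)) (hind : iIndepFun X P)
    {S : ℕ → Set β} (hS : ∀ i, MeasurableSet (S i))
    (hsum : ¬ Summable fun n => P.real {ω | X n ω ∈ S n}) :
    ∀ᵐ ω ∂P, ∃ᶠ n in atTop, X n ω ∈ S n := by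
  have := hind.isProbabilityMeasure
  have hm : ∀ n, MeasurableSet (X n ⁻¹' S n) := fun n => hX n (hS n)
  have hi : iIndepSet (fun n => X n ⁻¹' S n) P :=
    (iIndepSet_iff_meas_biInter hm).2 fun s => hind.meas_biInter fun i _ => ⟨S i, hS i, rfl⟩
  have htop : (∑' n, P (X n ⁻¹' S n)) = ⊤ := by
    by_contra h
    exact hsum (ENNReal.summable_toReal h)
  have h1 := measure_limsup_eq_one hm hi htop
  have hms : MeasurableSet (limsup (fun n => X n ⁻¹' S n) atTop) :=
    MeasurableSet.measurableSet_limsup hm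
  have h2 := (prob_compl_eq_zero_iff hms).2 h1
  rw [ae_iff]
  convert h2 using 2
  ext ω
  simp [mem_limsup_iff_frequently_mem]

/-- First Borel-Cantelli lemma, in terms of real-valued probabilities. -/
theorem ae_eventually_not_of_summable {Ω : Type*} [MeasurableSpace Ω]
    {P : Measure Ω} [IsFiniteMeasure P] {p : ℕ → Ω → Prop}
    (hsum : Summable fun n => P.real {ω | p n ω}) :
    ∀ᵐ ω ∂P, ∀ᶠ n in atTop, ¬ p n ω := by
  refine ae_eventually_notMem (s := fun n => {ω | p n ω}) ?_
  have : (fun n => P {ω | p n ω}) = fun n => ENNReal.ofReal (P.real {ω | p n ω}) := by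
    funext n; rw [ofReal_measureReal]
  rw [this, ← ENNReal.ofReal_tsum_of_nonneg (fun _ => measureReal_nonneg) hsum]
  exact ENNReal.ofReal_ne_top

/-! ### The geometric law -/

/-- The geometric law on `{1, 2, …}` with success probability `1/2`. -/
noncomputable def fairGeometric : Measure ℕ :=
  (geometricMeasure ⟨1 / 2, ⟨by norm_num, by norm_num⟩⟩).map (· + 1)

instance : IsProbabilityMeasure fairGeometric :=
  Measure.isProbabilityMeasure_map (by fun_prop)

/-- Independent random variables with values in `ℕ` and `P (X i = m) = 2⁻ᵐ` for `m ≥ 1`. -/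
structure IsGeometricSeq {Ω : Type*} [MeasurableSpace Ω] (X : ℕ → Ω → ℕ) (P : Measure Ω) :
    Prop where
  measurable : ∀ i, Measurable (X i)
  indep : iIndepFun X P
  law : ∀ i, P.map (X i) = fairGeometric

theorem fairGeometric_singleton (m : ℕ) :
    fairGeometric {m} = if m = 0 then 0 else ENNReal.ofReal ((1 / 2) ^ m) := by
  have hp : (⟨1 / 2, ⟨by norm_num, by norm_num⟩⟩ : unitInterval) ≠ 0 := by
    intro h
    have := congrArg Subtype.val h
    norm_num at this
  rw [fairGeometric, Measure.map_apply (by fun_prop) (measurableSet_singleton m)]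
  rcases m with _ | m
  · rw [show (fun x : ℕ => x + 1) ⁻¹' {0} = ∅ by ext; simp]
    simp
  · rw [show (fun x : ℕ => x + 1) ⁻¹' {m + 1} = {m} by ext; simp, geometricMeasure_singleton hp]
    simp only [Nat.add_eq_zero_iff, one_ne_zero, and_false, if_false]
    congr 1
    norm_num [pow_succ]

/-! ### Gaps as patterns of bits -/

section Gap

variable {Ω : Type*} {ε : ℕ → Ω → ℕ}

theorem jumpTime_succ (ε : ℕ → Ω → ℕ) (k : ℕ) (ω : Ω) :
    jumpTime ε (k + 1) ω = jumpTime ε k ω + gap ε (k + 1) ω := by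
  rw [jumpTime, Finset.sum_Icc_succ_top (by omega), jumpTime]

theorem jumpTime_eq_sum_range (ε : ℕ → Ω → ℕ) (k : ℕ) (ω : Ω) :
    jumpTime ε k ω = ∑ i ∈ Finset.range k, gap ε (i + 1) ω := by
  induction k with
  | zero => simp [jumpTime]
  | succ k ih => rw [jumpTime_succ, ih, Finset.sum_range_succ]

/-- Replaces the infimum by a condition on finitely many consecutive bits. A positive value already
certifies that the set is nonempty, because `sInf ∅ = 0`; this is why `1 ≤ m` is assumed and no null
event has to be removed. -/
theorem gap_eq_iff {ω : Ω} (h01 : ∀ j, 1 ≤ j → ε j ω = 0 ∨ ε j ω = 1) (k : ℕ) {m : ℕ}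
    (hm : 1 ≤ m) : gap ε (k + 1) ω = m ↔
      ∀ j < m, ε (jumpTime ε k ω + j + 1) ω = if j + 1 = m then 1 else 0 := by
  rw [gap_succ]
  constructor
  · rintro h j hj
    have hne : {n : ℕ | 1 ≤ n ∧ ε (n + jumpTime ε k ω) ω = 1}.Nonempty :=
      Nat.nonempty_of_pos_sInf (by omega)
    split_ifs with hjm
    · have h1 := (Nat.sInf_mem hne).2
      rw [h] at h1
      rw [← h1]; congr 1; omega
    · refine (h01 _ (by omega)).resolve_right fun h1 => ?_
      refine Nat.notMem_of_lt_sInf (m := j + 1)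
        (s := {n : ℕ | 1 ≤ n ∧ ε (n + jumpTime ε k ω) ω = 1}) (by omega) ⟨by omega, ?_⟩
      rw [← h1]; congr 1; omega
  · intro h
    have h1 : m ∈ {n : ℕ | 1 ≤ n ∧ ε (n + jumpTime ε k ω) ω = 1} := by
      refine ⟨hm, ?_⟩
      have := h (m - 1) (by omega)
      rw [if_pos (by omega)] at this
      rw [← this]; congr 1; omega
    refine le_antisymm (Nat.sInf_le h1) (not_lt.1 fun hlt => ?_)
    obtain ⟨h2, h3⟩ := Nat.sInf_mem ⟨m, h1⟩
    set s := sInf {n : ℕ | 1 ≤ n ∧ ε (n + jumpTime ε k ω) ω = 1} with hs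
    have := h (s - 1) (by omega)
    rw [if_neg (by omega), show jumpTime ε k ω + (s - 1) + 1 = s + jumpTime ε k ω by omega,
      h3] at this
    exact one_ne_zero this

/-- Prescribing the first gaps amounts to prescribing the first terms of the sequence. -/
theorem exists_pattern (m : ℕ → ℕ) (hm : ∀ i, 1 ≤ m i) (k : ℕ) :
    ∃ b : ℕ → ℕ, (∀ j, b j = 0 ∨ b j = 1) ∧
      ∀ (ε : ℕ → Ω → ℕ) (ω : Ω), (∀ j, 1 ≤ j → ε j ω = 0 ∨ ε j ω = 1) →
        ((∀ i < k, gap ε (i + 1) ω = m i) ↔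
          ∀ j < ∑ i ∈ Finset.range k, m i, ε (j + 1) ω = b j) := by
  induction k with
  | zero => exact ⟨fun _ => 0, fun _ => Or.inl rfl, by simp⟩
  | succ k ih =>
    obtain ⟨b, hb, h⟩ := ih
    set M := ∑ i ∈ Finset.range k, m i with hM
    -- The old word is followed by `m k - 1` zeros and a one; bit `j` of the word is `ε (j + 1)`, so
    -- the last one sits at `j + 1 = M + m k`.
    refine ⟨fun j => if j < M then b j else if j + 1 = M + m k then 1 else 0, fun j => ?_,
      fun ε ω h01 => ?_⟩
    · dsimp only
      split_ifs
      · exact hb j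
      · exact Or.inr rfl
      · exact Or.inl rfl
    · rw [Finset.sum_range_succ, ← hM, Nat.forall_lt_succ_right, h ε ω h01]
      constructor
      · rintro ⟨h1, h2⟩ j hj
        have hJ : jumpTime ε k ω = M := by
          rw [jumpTime_eq_sum_range, hM]
          exact Finset.sum_congr rfl fun i hi =>
            (h ε ω h01).2 h1 i (Finset.mem_range.1 hi)
        dsimp only
        split_ifs with h3 h4
        · exact h1 j h3
        · have := (gap_eq_iff h01 k (hm k)).1 h2 (j - M) (by omega)
          rw [if_pos (by omega), hJ, show M + (j - M) = j by omega] at this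
          exact this
        · have := (gap_eq_iff h01 k (hm k)).1 h2 (j - M) (by omega)
          rw [if_neg (by omega), hJ, show M + (j - M) = j by omega] at this
          exact this
      · intro h1
        have h0 : ∀ j < M, ε (j + 1) ω = b j := fun j hj => by
          have := h1 j (by omega)
          simpa only [if_pos hj] using this
        have hJ : jumpTime ε k ω = M := by
          rw [jumpTime_eq_sum_range, hM]
          exact Finset.sum_congr rfl fun i hi =>
            (h ε ω h01).2 h0 i (Finset.mem_range.1 hi)
        refine ⟨h0, (gap_eq_iff h01 k (hm k)).2 fun j hj => ?_⟩
        have := h1 (M + j) (by omega)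
        simp only [if_neg (show ¬ M + j < M by omega)] at this
        rw [hJ, this]
        congr 1
        simp only [eq_iff_iff]; omega

end Gap

/-! ### Independence and law of the gaps -/

namespace IsFairBernoulliSeq

variable {Ω : Type*} [MeasurableSpace Ω] {P : Measure Ω} {ε : ℕ → Ω → ℕ}

theorem ae_frequently_one (hε : IsFairBernoulliSeq ε P) :
    ∀ᵐ ω ∂P, ∃ᶠ n in atTop, ε (n + 1) ω = 1 := by
  refine ae_frequently_mem_of_not_summable (S := fun _ => {1})
    (fun i => hε.measurable (i + 1) (by omega)) hε.indep (fun _ => measurableSet_singleton 1) ?_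
  simp only [Set.mem_singleton_iff]
  intro h
  have h2 := h.tendsto_atTop_zero
  simp only [hε.prob_one _ (Nat.le_add_left 1 _)] at h2
  have := tendsto_nhds_unique h2 tendsto_const_nhds
  norm_num at this

theorem ae_nonempty (hε : IsFairBernoulliSeq ε P) :
    ∀ᵐ ω ∂P, ∀ ℓ : ℕ, 1 ≤ ℓ →
      {n : ℕ | 1 ≤ n ∧ ε (n + jumpTime ε (ℓ - 1) ω) ω = 1}.Nonempty := by
  filter_upwards [hε.ae_frequently_one] with ω hω ℓ _
  obtain ⟨n, hn, h1⟩ := frequently_atTop.1 hω (jumpTime ε (ℓ - 1) ω)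
  exact ⟨n + 1 - jumpTime ε (ℓ - 1) ω, by omega, by
    rwa [Nat.sub_add_cancel (by omega)]⟩

theorem ae_one_le_gap (hε : IsFairBernoulliSeq ε P) : ∀ᵐ ω ∂P, ∀ k, 1 ≤ gap ε (k + 1) ω := by
  filter_upwards [hε.ae_nonempty] with ω hω k
  rw [gap_succ]
  exact (Nat.sInf_mem (hω (k + 1) (by omega))).1

theorem measurable_sInf_eq_one (hε : IsFairBernoulliSeq ε P) (a : ℕ) :
    Measurable fun ω => sInf {n : ℕ | 1 ≤ n ∧ ε (n + a) ω = 1} := by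
  have hm : ∀ n, MeasurableSet {ω | 1 ≤ n ∧ ε (n + a) ω = 1} := by
    intro n
    by_cases hn : 1 ≤ n
    · simp only [hn, true_and]
      exact hε.measurable (n + a) (by omega) (measurableSet_singleton 1)
    · simp [hn]
  refine measurable_to_countable' fun m => ?_
  -- The second piece accounts for the default value `sInf ∅ = 0`.
  have : (fun ω => sInf {n : ℕ | 1 ≤ n ∧ ε (n + a) ω = 1}) ⁻¹' {m} =
      ({ω | 1 ≤ m ∧ ε (m + a) ω = 1} ∩ ⋂ n, ⋂ (_ : n < m), {ω | 1 ≤ n ∧ ε (n + a) ω = 1}ᶜ) ∪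
        ({_ω | m = 0} ∩ ⋂ n, {ω | 1 ≤ n ∧ ε (n + a) ω = 1}ᶜ) := by
    ext ω
    simp only [Set.mem_preimage, Set.mem_singleton_iff, Set.mem_union, Set.mem_inter_iff,
      Set.mem_iInter, Set.mem_compl_iff]
    constructor
    · rintro rfl
      rcases Set.eq_empty_or_nonempty {n : ℕ | 1 ≤ n ∧ ε (n + a) ω = 1} with h | h
      · right
        refine ⟨by simp [h], fun n hn => ?_⟩
        have : n ∈ {n : ℕ | 1 ≤ n ∧ ε (n + a) ω = 1} := hn
        rw [h] at this
        exact this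
      · exact Or.inl ⟨Nat.sInf_mem h, fun n hn hn' => Nat.notMem_of_lt_sInf hn hn'⟩
    · rintro (⟨h1, h2⟩ | ⟨h1, h2⟩)
      · refine le_antisymm (Nat.sInf_le h1) (not_lt.1 fun h => ?_)
        exact h2 _ h (Nat.sInf_mem (s := {n : ℕ | 1 ≤ n ∧ ε (n + a) ω = 1}) ⟨m, h1⟩)
      · have : {n : ℕ | 1 ≤ n ∧ ε (n + a) ω = 1} = ∅ := by
          ext n; exact ⟨fun h => (h2 n h).elim, fun h => h.elim⟩
        rw [this]; simpa using h1.symm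
  rw [this]
  exact ((hm m).inter (MeasurableSet.iInter fun n => MeasurableSet.iInter fun _ =>
    (hm n).compl)).union ((MeasurableSet.const _).inter (MeasurableSet.iInter fun n => (hm n).compl))

/-- A gap is a waiting time evaluated at a random starting point. With countably many starting
points, measurability for each fixed one gives joint measurability, and the two claims then feed
each other by induction. -/
theorem measurable_jumpTime_and_gap (hε : IsFairBernoulliSeq ε P) (k : ℕ) :
    Measurable (jumpTime ε k) ∧ Measurable (gap ε (k + 1)) := by
  have key : ∀ k, Measurable (jumpTime ε k) → Measurable (gap ε (k + 1)) := by
    intro k hk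
    have h : Measurable fun p : Ω × ℕ => sInf {n : ℕ | 1 ≤ n ∧ ε (n + p.2) p.1 = 1} :=
      measurable_from_prod_countable_left fun a => hε.measurable_sInf_eq_one a
    have h2 := h.comp (measurable_id.prodMk hk)
    convert h2 using 1
    funext ω
    exact gap_succ ε k ω
  induction k with
  | zero =>
    have h0 : Measurable (jumpTime ε 0) := by
      have : jumpTime ε 0 = fun _ => 0 := by funext ω; simp [jumpTime]
      rw [this]; exact measurable_const
    exact ⟨h0, key 0 h0⟩
  | succ k ih =>
    have h0 : Measurable (jumpTime ε (k + 1)) := by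
      have : jumpTime ε (k + 1) = fun ω => jumpTime ε k ω + gap ε (k + 1) ω := by
        funext ω; exact jumpTime_succ ε k ω
      rw [this]; exact ih.1.add ih.2
    exact ⟨h0, key _ h0⟩

variable [IsProbabilityMeasure P]

theorem prob_eq (hε : IsFairBernoulliSeq ε P) {j b : ℕ} (hj : 1 ≤ j) (hb : b = 0 ∨ b = 1) :
    P {ω | ε j ω = b} = ENNReal.ofReal (1 / 2) := by
  rw [← ofReal_measureReal]
  rcases hb with rfl | rfl
  · rw [hε.prob_zero j hj]
  · rw [hε.prob_one j hj]

theorem ae_zero_or_one (hε : IsFairBernoulliSeq ε P) :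
    ∀ᵐ ω ∂P, ∀ j, 1 ≤ j → ε j ω = 0 ∨ ε j ω = 1 := by
  rw [ae_all_iff]
  intro j
  by_cases hj : 1 ≤ j
  swap
  · exact Eventually.of_forall fun _ h => (hj h).elim
  simp only [hj, forall_const]
  have hm := hε.measurable j hj
  have h0 : MeasurableSet {ω | ε j ω = 0} := hm (measurableSet_singleton 0)
  have h1 : MeasurableSet {ω | ε j ω = 1} := hm (measurableSet_singleton 1)
  have hd : Disjoint {ω | ε j ω = 0} {ω | ε j ω = 1} := by
    rw [Set.disjoint_left]; intro ω h h'; simp only [Set.mem_ofPred_eq] at h h'; omega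
  have hu : P.real ({ω | ε j ω = 0} ∪ {ω | ε j ω = 1}) = 1 := by
    rw [measureReal_union hd h1, hε.prob_zero j hj, hε.prob_one j hj]; norm_num
  have hu' : P ({ω | ε j ω = 0} ∪ {ω | ε j ω = 1}) = 1 := by
    rw [← ofReal_measureReal, hu, ENNReal.ofReal_one]
  rw [← prob_compl_eq_zero_iff (h0.union h1)] at hu'
  rw [ae_iff]
  convert hu' using 2
  ext ω
  simp

theorem prob_pattern (hε : IsFairBernoulliSeq ε P) {b : ℕ → ℕ} (hb : ∀ j, b j = 0 ∨ b j = 1)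
    (M : ℕ) : P {ω | ∀ j < M, ε (j + 1) ω = b j} = ENNReal.ofReal ((1 / 2) ^ M) := by
  have : {ω | ∀ j < M, ε (j + 1) ω = b j} =
      ⋂ j ∈ Finset.range M, ε (j + 1) ⁻¹' {b j} := by ext; simp
  rw [this, hε.indep.meas_biInter fun j _ => ⟨{b j}, measurableSet_singleton _, rfl⟩,
    Finset.prod_congr rfl fun j _ =>
      show P (ε (j + 1) ⁻¹' {b j}) = _ from hε.prob_eq (by omega) (hb j)]
  rw [Finset.prod_const, Finset.card_range, ENNReal.ofReal_pow (by norm_num)]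

/-- Both measures live on a countable space, so comparing singletons is enough. A point with
positive coordinates is a bit pattern; a point with a zero coordinate is null on both sides. -/
theorem map_gap_fin (hε : IsFairBernoulliSeq ε P) (k : ℕ) :
    P.map (fun ω (i : Fin k) => gap ε (i + 1) ω) = 
      Measure.pi fun _ => fairGeometric := by
  refine Measure.ext_of_singleton fun m => ?_
  have hmeas : Measurable fun ω (i : Fin k) => gap ε (i + 1) ω :=
    measurable_pi_lambda _ fun i => (hε.measurable_jumpTime_and_gap i).2
  rw [Measure.map_apply hmeas (measurableSet_singleton m), Measure.pi_singleton]
  simp only [fairGeometric_singleton]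
  by_cases hm : ∀ i, 1 ≤ m i
  -- Indices beyond `k` get the harmless value `1`, only to keep every prescribed gap positive.
  · set m' : ℕ → ℕ := fun i => if h : i < k then m ⟨i, h⟩ else 1 with hm'
    obtain ⟨b, hb, h⟩ := exists_pattern (Ω := Ω) m' (fun i => by
      simp only [hm']; split_ifs; exacts [hm _, le_rfl]) k
    have hsum : ∑ i ∈ Finset.range k, m' i = ∑ i, m i := by
      rw [← Fin.sum_univ_eq_sum_range]
      exact Finset.sum_congr rfl fun i _ => by simp [hm']
    rw [Finset.prod_congr rfl fun i _ => if_neg (by have := hm i; omega),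
      ← ENNReal.ofReal_prod_of_nonneg (fun _ _ => by positivity), Finset.prod_pow_eq_pow_sum,
      ← hsum, ← hε.prob_pattern hb]
    refine measure_congr ?_
    filter_upwards [hε.ae_zero_or_one] with ω hω
    apply propext
    refine Iff.trans ?_ (h ε ω hω)
    simp only [hm']
    constructor
    · intro h i hi
      rw [dif_pos hi]
      exact congrFun h ⟨i, hi⟩
    · intro h
      funext i
      have := h i i.2
      rwa [dif_pos i.2] at this
  · push Not at hm
    obtain ⟨i, hi⟩ := hm
    rw [show ∏ i, (if m i = 0 then (0 : ENNReal) else ENNReal.ofReal ((1 / 2) ^ m i)) = 0 from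
      Finset.prod_eq_zero (Finset.mem_univ i) (if_pos (by omega)), measure_eq_zero_iff_ae_notMem]
    filter_upwards [hε.ae_one_le_gap] with ω hω h
    have := congrFun h i
    have h2 := hω i
    simp only at this
    omega

theorem isGeometricSeq_gap (hε : IsFairBernoulliSeq ε P) :
    IsGeometricSeq (fun ℓ => gap ε (ℓ + 1)) P := by
  have hmeas := fun k => (hε.measurable_jumpTime_and_gap k).2
  have hlaw : ∀ i, P.map (gap ε (i + 1)) = fairGeometric := by
    intro i
    have h := congrArg (Measure.map (Function.eval (Fin.last i))) (hε.map_gap_fin (i + 1))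
    rw [Measure.map_map (measurable_pi_apply _)
      (measurable_pi_lambda _ fun j : Fin (i + 1) => hmeas j),
      Measure.pi_map_eval] at h
    simpa [Function.comp_def] using h
  refine ⟨hmeas, iIndepFun_iff_finset.2 fun s => ?_, hlaw⟩
  obtain ⟨k, hk⟩ := s.exists_nat_subset_range
  have h : iIndepFun (fun (i : Fin k) => gap ε (i + 1)) P := by
    rw [iIndepFun_iff_map_fun_eq_pi_map fun i : Fin k => (hmeas i).aemeasurable, hε.map_gap_fin]
    simp_rw [hlaw]
  exact h.precomp (g := fun i : s => ⟨i, Finset.mem_range.1 (hk i.2)⟩) fun i j hij => by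
    exact Subtype.ext (congrArg Fin.val hij)

end IsFairBernoulliSeq

/-! ### Discrete expectations, convolutions and the binomial law -/

/-- The expectation of a function of an integer-valued random variable, as a series. -/
theorem hasSum_integral_comp_nat {Ω E : Type*} [MeasurableSpace Ω] {P : Measure Ω}
    [IsProbabilityMeasure P] [NormedAddCommGroup E] [NormedSpace ℝ E] [CompleteSpace E]
    {Y : Ω → ℕ} (hY : Measurable Y) (f : ℕ → E) (hf : Integrable (fun ω => f (Y ω)) P) :
    HasSum (fun n => P.real {ω | Y ω = n} • f n) (∫ ω, f (Y ω) ∂P) := by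
  have hsf : StronglyMeasurable f := .of_discrete
  have h1 : Integrable f (P.map Y) :=
    (integrable_map_measure hsf.aestronglyMeasurable hY.aemeasurable).2 hf
  rw [← integral_map hY.aemeasurable hsf.aestronglyMeasurable]
  have h2 := hasSum_integral_iUnion (μ := P.map Y) (f := f) (s := fun n : ℕ => {n})
    (fun n => measurableSet_singleton n) (fun i j hij => by simpa using hij) h1.integrableOn
  rw [Set.iUnion_of_singleton, setIntegral_univ] at h2
  convert h2 using 2 with n
  rw [integral_singleton, map_measureReal_apply hY (measurableSet_singleton n)]
  rfl

theorem IndepFun.real_inter_eq_mul {Ω : Type*} [MeasurableSpace Ω] {P : Measure Ω}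
    {X Y : Ω → ℕ} (h : IndepFun X Y P) (a b : ℕ) :
    P.real {ω | X ω = a ∧ Y ω = b} = P.real {ω | X ω = a} * P.real {ω | Y ω = b} := by
  rw [measureReal_def, measureReal_def, measureReal_def, ← ENNReal.toReal_mul]
  congr 1
  exact h.measure_inter_preimage_eq_mul {a} {b} (measurableSet_singleton a)
    (measurableSet_singleton b)

/-- The law of a sum of two independent integer-valued random variables. -/
theorem real_add_eq_sum_antidiagonal {Ω : Type*} [MeasurableSpace Ω] {P : Measure Ω}
    [IsProbabilityMeasure P] {X Y : Ω → ℕ} (hX : Measurable X) (hY : Measurable Y)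
    (h : IndepFun X Y P) (n : ℕ) :
    P.real {ω | X ω + Y ω = n} =
      ∑ p ∈ Finset.HasAntidiagonal.antidiagonal n, P.real {ω | X ω = p.1} * P.real {ω | Y ω = p.2} := by
  have : {ω | X ω + Y ω = n} =
      ⋃ p ∈ Finset.HasAntidiagonal.antidiagonal n, {ω | X ω = p.1 ∧ Y ω = p.2} := by
    ext ω
    simp only [Set.mem_ofPred_eq, Set.mem_iUnion, Finset.HasAntidiagonal.mem_antidiagonal, exists_prop]
    exact ⟨fun h => ⟨(X ω, Y ω), h, rfl, rfl⟩, fun ⟨p, h, h1, h2⟩ => by omega⟩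
  rw [this, measureReal_biUnion_finset]
  · exact Finset.sum_congr rfl fun p _ => IndepFun.real_inter_eq_mul h _ _
  · intro p _ q _ hpq
    rw [Function.onFun, Set.disjoint_left]
    rintro ω ⟨h1, h2⟩ ⟨h3, h4⟩
    exact hpq (Prod.ext (h1.symm.trans h3) (h2.symm.trans h4))
  · exact fun p _ => (hX (measurableSet_singleton _)).inter (hY (measurableSet_singleton _))

/-- The hockey-stick identity, which drives the convolution step for negative binomial laws. -/
theorem sum_range_choose_eq (d N : ℕ) :
    ∑ j ∈ Finset.range N, j.choose d = N.choose (d + 1) := by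
  induction N with
  | zero => simp
  | succ N ih => rw [Finset.sum_range_succ, ih, Nat.choose_succ_succ, add_comm]

namespace IsFairBernoulliSeq

variable {Ω : Type*} [MeasurableSpace Ω] {P : Measure Ω} [IsProbabilityMeasure P]
  {ε : ℕ → Ω → ℕ}

/-- Pascal's rule: in the convolution with one more bit, only the values `0` and `1` of that bit
carry mass. -/
theorem real_bernoulliSum_eq (hε : IsFairBernoulliSeq ε P) (n k : ℕ) :
    P.real {ω | bernoulliSum ε n ω = k} = (n.choose k : ℝ) / 2 ^ n := by
  have hB : ∀ n, bernoulliSum ε n = ∑ i ∈ Finset.range n, ε (i + 1) := by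
    intro n
    funext ω
    rw [Finset.sum_apply, bernoulliSum, Finset.range_eq_Ico,
      Finset.sum_Ico_add' (fun i => ε i ω) 0 n 1]
    rfl
  have hmeas : ∀ n, Measurable (bernoulliSum ε n) := fun n => by
    
    have := Finset.measurable_fun_sum (Finset.range n)
      fun i _ => hε.measurable (i + 1) (by omega)
    rw [hB]; convert this using 1; ext; simp
  induction n generalizing k with
  | zero =>
    rcases k with _ | k
    · simp [bernoulliSum]
    · simp [bernoulliSum]
  | succ n ih =>
    have hind : IndepFun (ε (n + 1)) (bernoulliSum ε n) P := by
      rw [hB]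
      exact (hε.indep.indepFun_finsetSum_of_notMem
        (fun i => hε.measurable _ (by omega)) (s := Finset.range n) (i := n) (by simp)).symm
    have hs : ∀ ω, bernoulliSum ε (n + 1) ω = ε (n + 1) ω + bernoulliSum ε n ω := by
      intro ω; rw [bernoulliSum, Finset.sum_Icc_succ_top (by omega), add_comm]; rfl
    simp_rw [hs]
    have hge : ∀ x, 2 ≤ x → P.real {ω | ε (n + 1) ω = x} = 0 := by
      intro x hx
      rw [measureReal_eq_zero_iff, measure_eq_zero_iff_ae_notMem]
      filter_upwards [hε.ae_zero_or_one] with ω hω h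
      have := hω (n + 1) (by omega)
      change ε (n + 1) ω = x at h
      omega
    rw [real_add_eq_sum_antidiagonal (hε.measurable _ (by omega)) (hmeas n) hind,
      Finset.Nat.sum_antidiagonal_eq_sum_range_succ_mk]
    simp only [ih]
    rcases k with _ | k
    · rw [Finset.sum_range_one, hε.prob_zero _ (by omega)]
      simp [pow_succ]
    · rw [Finset.sum_range_succ', Finset.sum_range_succ', Finset.sum_eq_zero fun i _ => by
        rw [hge _ (by omega), zero_mul], zero_add, hε.prob_one _ (by omega),
        hε.prob_zero _ (by omega), Nat.choose_succ_succ']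
      push_cast
      ring

end IsFairBernoulliSeq

/-! ### Moments, generating functions and tails for geometric variables -/

namespace IsGeometricSeq

variable {Ω : Type*} [MeasurableSpace Ω] {P : Measure Ω} {X : ℕ → Ω → ℕ}

theorem isProbabilityMeasure (hX : IsGeometricSeq X P) : IsProbabilityMeasure P :=
  hX.indep.isProbabilityMeasure

theorem real_eq (hX : IsGeometricSeq X P) (i m : ℕ) :
    P.real {ω | X i ω = m} = if m = 0 then 0 else (1 / 2) ^ m := by
  have := hX.isProbabilityMeasure
  have h : P {ω | X i ω = m} = _ :=
    (Measure.map_apply (hX.measurable i) (measurableSet_singleton m)).symm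
  rw [measureReal_def, h, hX.law, fairGeometric_singleton]
  split_ifs
  · simp
  · rw [ENNReal.toReal_ofReal (by positivity)]

theorem measurable_sum (hX : IsGeometricSeq X P) (s : Finset ℕ) :
    Measurable fun ω => ∑ i ∈ s, X i ω :=
  Finset.measurable_fun_sum s fun i _ => hX.measurable i

/-- A sum of `d + 1` independent geometric variables has a negative binomial law. -/
theorem real_sum_eq (hX : IsGeometricSeq X P) {s : Finset ℕ} (hs : s.Nonempty) (n : ℕ) :
    P.real {ω | ∑ i ∈ s, X i ω = n} =
      if n = 0 then 0 else ((n - 1).choose (s.card - 1) : ℝ) / 2 ^ n := by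
  have := hX.isProbabilityMeasure
  induction hs using Finset.Nonempty.cons_induction generalizing n with
  | singleton a =>
    simp only [Finset.sum_singleton, hX.real_eq, Finset.card_singleton, Nat.sub_self,
      Nat.choose_zero_right, Nat.cast_one, one_div, inv_pow]
  | cons a s ha hs ih =>
    have hind : IndepFun (X a) (fun ω => ∑ i ∈ s, X i ω) P := by
      have := (hX.indep.indepFun_finsetSum_of_notMem hX.measurable ha).symm
      convert this using 1
      ext; simp
    simp only [Finset.sum_cons, Finset.card_cons]
    rw [real_add_eq_sum_antidiagonal (hX.measurable a) (hX.measurable_sum s) hind,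
      ← Finset.Nat.sum_antidiagonal_swap, Finset.Nat.sum_antidiagonal_eq_sum_range_succ_mk]
    simp only [ih, Prod.swap_prod_mk, hX.real_eq]
    rcases n with _ | n
    · simp
    · obtain ⟨d, hd⟩ : ∃ d, s.card = d + 1 := ⟨s.card - 1, by have := hs.card_pos; omega⟩
      -- Both end terms of the convolution vanish, since neither the new variable nor the old sum
      -- takes the value `0`; what remains is a hockey-stick sum.
      rw [Finset.sum_range_succ, Finset.sum_range_succ', hd, if_neg (by omega : n + 1 ≠ 0)]
      simp only [Nat.sub_self, if_true, zero_mul, mul_zero, add_zero, Nat.add_sub_cancel]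
      rw [← sum_range_choose_eq]
      push_cast
      rw [Finset.sum_div]
      refine Finset.sum_congr rfl fun j hj => ?_
      have hj := Finset.mem_range.1 hj
      simp only [if_neg (show n - j ≠ 0 by omega), one_div, inv_pow]
      rw [show (2 : ℝ) ^ (n + 1) = 2 ^ (n - j) * 2 ^ (j + 1) by rw [← pow_add]; congr 1; omega]
      field_simp

/-- Expectations of functions of a geometric variable, as series. -/
theorem integrable_comp_and_hasSum (hX : IsGeometricSeq X P) (i : ℕ) {E : Type*}
    [NormedAddCommGroup E] [NormedSpace ℝ E] [CompleteSpace E] (f : ℕ → E)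
    (hf : Summable fun n => (1 / 2 : ℝ) ^ (n + 1) * ‖f (n + 1)‖) :
    Integrable (fun ω => f (X i ω)) P ∧
      HasSum (fun n => (1 / 2 : ℝ) ^ (n + 1) • f (n + 1)) (∫ ω, f (X i ω) ∂P) := by
  have := hX.isProbabilityMeasure
  have hp : (⟨1 / 2, ⟨by norm_num, by norm_num⟩⟩ : unitInterval) ≠ 0 := by
    intro h
    have := congrArg Subtype.val h
    norm_num at this
  have hsf : StronglyMeasurable f := .of_discrete
  have h1 : Integrable f fairGeometric := by
    rw [fairGeometric, integrable_map_measure hsf.aestronglyMeasurable (by fun_prop),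
      integrable_geometricMeasure_iff hp]
    refine hf.congr fun n => ?_
    rw [pow_succ, Function.comp_apply]
    norm_num
  rw [← hX.law i] at h1
  have hint := (integrable_map_measure hsf.aestronglyMeasurable (hX.measurable i).aemeasurable).1 h1
  refine ⟨hint, ?_⟩
  have h2 := hasSum_integral_comp_nat (hX.measurable i) f hint
  rw [← hasSum_nat_add_iff' 1] at h2
  simp only [hX.real_eq, Finset.sum_range_one, if_true, zero_smul, sub_zero] at h2
  exact h2

/-- Probability generating function of the geometric law. -/
theorem integrable_pow_and_integral (hX : IsGeometricSeq X P) (i : ℕ) {𝕜 : Type*} [RCLike 𝕜]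
    {z : 𝕜} (hz : ‖z‖ < 2) :
    Integrable (fun ω => z ^ X i ω) P ∧ ∫ ω, z ^ X i ω ∂P = z / (2 - z) := by
  have hz2 : ‖z / 2‖ < 1 := by
    rw [norm_div, RCLike.norm_ofNat]; linarith
  obtain ⟨hint, hsum⟩ := hX.integrable_comp_and_hasSum i (fun n => z ^ n) (by
    refine ((summable_geometric_of_lt_one (norm_nonneg _) hz2).mul_left ‖z / 2‖).congr fun n => ?_
    rw [← pow_succ', norm_div, RCLike.norm_ofNat, norm_pow, div_pow, div_pow, one_pow]
    ring)
  refine ⟨hint, hsum.unique ?_⟩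
  have h3 := (hasSum_geometric_of_norm_lt_one hz2).mul_left (z / 2)
  have hne : (2 : 𝕜) - z ≠ 0 := by
    intro h
    rw [sub_eq_zero] at h
    rw [← h, RCLike.norm_ofNat] at hz
    exact lt_irrefl _ hz
  rw [show z / (2 - z) = z / 2 * (1 - z / 2)⁻¹ by
      rw [show 1 - z / 2 = (2 - z) / 2 by rw [sub_div, div_self two_ne_zero], inv_div,
        div_mul_div_cancel₀ two_ne_zero]]
  refine h3.congr_fun fun n => ?_
  rw [RCLike.real_smul_eq_coe_mul, ← pow_succ', div_pow]
  push_cast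
  rw [div_pow, one_pow]
  ring

theorem integrable_natCast_and_integral (hX : IsGeometricSeq X P) (i : ℕ) :
    Integrable (fun ω => (X i ω : ℝ)) P ∧ ∫ ω, (X i ω : ℝ) ∂P = 2 := by
  have h := (hasSum_choose_mul_geometric_of_norm_lt_one 1
    (r := (1 / 2 : ℝ)) (by norm_num)).mul_left (1 / 2)
  have heq : ∀ n : ℕ, (1 / 2 : ℝ) ^ (n + 1) * ((n + 1 : ℕ) : ℝ) =
      1 / 2 * (((n + 1).choose 1 : ℝ) * (1 / 2) ^ n) := fun n => by
    rw [Nat.choose_one_right, pow_succ]; ring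
  obtain ⟨hint, hsum⟩ := hX.integrable_comp_and_hasSum i (fun n => (n : ℝ))
    (h.summable.congr fun n => by rw [Real.norm_natCast, heq])
  refine ⟨hint, (hsum.unique (h.congr_fun heq)).trans ?_⟩
  norm_num

/-- Uses `(n+1)² = 2·C(n+2, 2) - C(n+1, 1)` to reduce the second moment to negative binomial series.
-/
theorem integrable_sq_and_integral (hX : IsGeometricSeq X P) (i : ℕ) :
    Integrable (fun ω => (X i ω : ℝ) ^ 2) P ∧ ∫ ω, (X i ω : ℝ) ^ 2 ∂P = 6 := by
  have h1 := (hasSum_choose_mul_geometric_of_norm_lt_one 1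
    (r := (1 / 2 : ℝ)) (by norm_num)).mul_left (1 / 2)
  have h2 := (hasSum_choose_mul_geometric_of_norm_lt_one 2
    (r := (1 / 2 : ℝ)) (by norm_num))
  have h := h2.sub h1
  have heq : ∀ n : ℕ, (1 / 2 : ℝ) ^ (n + 1) * ((n + 1 : ℕ) : ℝ) ^ 2 =
      ((n + 2).choose 2 : ℝ) * (1 / 2) ^ n - 1 / 2 * (((n + 1).choose 1 : ℝ) * (1 / 2) ^ n) :=
    fun n => by
      rw [Nat.choose_one_right, pow_succ, Nat.cast_choose_two]; push_cast; ring
  obtain ⟨hint, hsum⟩ := hX.integrable_comp_and_hasSum i (fun n => (n : ℝ) ^ 2)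
    (h.summable.congr fun n => by rw [norm_pow, Real.norm_natCast, heq])
  refine ⟨hint, (hsum.unique (h.congr_fun heq)).trans ?_⟩
  norm_num

theorem memLp_two (hX : IsGeometricSeq X P) (i : ℕ) : MemLp (fun ω => (X i ω : ℝ)) 2 P :=
  (memLp_two_iff_integrable_sq
    (hX.integrable_natCast_and_integral i).1.aestronglyMeasurable).2
    (hX.integrable_sq_and_integral i).1

theorem variance_eq (hX : IsGeometricSeq X P) (i : ℕ) :
    variance (fun ω => (X i ω : ℝ)) P = 2 := by
  have := hX.isProbabilityMeasure
  rw [variance_eq_sub (hX.memLp_two i), (hX.integrable_natCast_and_integral i).2]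
  have : ∫ ω, ((fun ω => (X i ω : ℝ)) ^ 2) ω ∂P = 6 := (hX.integrable_sq_and_integral i).2
  rw [this]
  norm_num

theorem iIndepFun_natCast (hX : IsGeometricSeq X P) :
    iIndepFun (fun i ω => (X i ω : ℝ)) P :=
  hX.indep.comp (fun _ n => (n : ℝ)) fun _ => by fun_prop

theorem variance_sum_eq (hX : IsGeometricSeq X P) (s : Finset ℕ) :
    variance (fun ω => ∑ i ∈ s, (X i ω : ℝ)) P = 2 * s.card := by
  have h := IndepFun.variance_sum (s := s) (fun i _ => hX.memLp_two i)
    fun i _ j _ hij => hX.iIndepFun_natCast.indepFun hij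
  have h2 : (∑ i ∈ s, fun ω => (X i ω : ℝ)) = fun ω => ∑ i ∈ s, (X i ω : ℝ) := by ext; simp
  rw [h2] at h
  rw [h, Finset.sum_congr rfl fun i _ => hX.variance_eq i, Finset.sum_const, nsmul_eq_mul, mul_comm]

theorem integral_sum_eq (hX : IsGeometricSeq X P) (s : Finset ℕ) :
    ∫ ω, ∑ i ∈ s, (X i ω : ℝ) ∂P = 2 * s.card := by
  rw [integral_finsetSum _ fun i _ => (hX.integrable_natCast_and_integral i).1,
    Finset.sum_congr rfl fun i _ => (hX.integrable_natCast_and_integral i).2,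
    Finset.sum_const, nsmul_eq_mul, mul_comm]

theorem integral_pow_sum (hX : IsGeometricSeq X P) (s : Finset ℕ) {z : ℂ} (hz : ‖z‖ < 2) :
    ∫ ω, z ^ (∑ i ∈ s, X i ω) ∂P = (z / (2 - z)) ^ s.card := by
  have h := (hX.indep.restrict s).integral_fun_prod_comp (𝕜 := ℂ) (f := fun _ n => z ^ n)
    (fun i => (hX.measurable i).aemeasurable) fun i => by fun_prop
  simp only [Finset.restrict, (hX.integrable_pow_and_integral _ hz).2, Finset.prod_const,
    Finset.card_univ, Fintype.card_coe] at h
  rw [← h]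
  refine integral_congr_ae (Eventually.of_forall fun ω => ?_)
  simp only
  rw [Finset.prod_pow_eq_pow_sum, Finset.sum_coe_sort s fun i => X i ω]

/-- Tail of a geometric variable. -/
theorem real_lt_eq (hX : IsGeometricSeq X P) (i n : ℕ) :
    P.real {ω | n < X i ω} = (1 / 2) ^ n := by
  have := hX.isProbabilityMeasure
  have hm : ∀ m, MeasurableSet {ω | X i ω = m} :=
    fun m => hX.measurable i (measurableSet_singleton m)
  induction n with
  | zero =>
    have : P {ω | 0 < X i ω} = 1 := by
      rw [← ofReal_measureReal, ← ENNReal.ofReal_one]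
      congr 1
      have h : {ω | 0 < X i ω} = {ω | X i ω = 0}ᶜ := by
        ext ω; simp [Nat.pos_iff_ne_zero]
      rw [h, probReal_compl_eq_one_sub (hm 0),
        hX.real_eq, if_pos rfl, sub_zero]
    rw [measureReal_def, this]; simp
  | succ n ih =>
    have h : {ω | n < X i ω} = {ω | n + 1 < X i ω} ∪ {ω | X i ω = n + 1} := by
      ext ω; simp only [Set.mem_union, Set.mem_ofPred_eq]; omega
    rw [h, measureReal_union (Set.disjoint_left.2 fun ω h1 h2 => by
        change n + 1 < X i ω at h1; change X i ω = n + 1 at h2; omega)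
      (hm (n + 1)), hX.real_eq, if_neg (by omega)] at ih
    rw [pow_succ] at ih ⊢
    linarith

end IsGeometricSeq

/-! ### Estimates for the centred characteristic function, and Fourier inversion -/

section FourierBounds

open Complex in
theorem norm_exp_I_sub_one_sub_le (t : ℝ) : ‖cexp (I * t) - 1 - I * t‖ ≤ 2 * t ^ 2 := by
  have hn : ‖I * (t : ℂ)‖ = |t| := by simp
  rcases le_or_gt |t| 1 with h | h
  · have := norm_exp_sub_one_sub_id_le (x := I * t) (by rwa [hn])
    rw [hn, sq_abs] at this
    nlinarith [sq_nonneg t]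
  · have h1 : ‖cexp (I * t) - 1‖ ≤ |t| := Real.norm_exp_I_mul_ofReal_sub_one_le
    have h2 := norm_sub_le (cexp (I * t) - 1) (I * t)
    rw [hn] at h2
    rw [← sq_abs]
    nlinarith

/-- The characteristic function of a centred geometric variable. -/
noncomputable def centredChar (t : ℝ) : ℂ := 1 / (1 - (Complex.exp (Complex.I * t) - 1) ^ 2)

-- With `z = e^{it}`, the centred transform is `z⁻² · z/(2 - z) = 1/(z(2 - z))`. Completing the
-- square exhibits the small quantity `z - 1`.
open Complex in
theorem one_sub_sq_eq (t : ℝ) :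
    1 - (cexp (I * t) - 1) ^ 2 = cexp (I * t) * (2 - cexp (I * t)) := by ring

open Complex in
theorem norm_exp_I_mul (t : ℝ) : ‖cexp (I * t)‖ = 1 := by
  rw [mul_comm]; exact norm_exp_ofReal_mul_I t

open Complex in
theorem one_le_norm_two_sub (t : ℝ) : 1 ≤ ‖2 - cexp (I * t)‖ := by
  have := norm_sub_norm_le (2 : ℂ) (cexp (I * t))
  rw [norm_exp_I_mul] at this
  norm_num at this
  linarith

theorem two_sub_exp_ne_zero (t : ℝ) : 2 - Complex.exp (Complex.I * t) ≠ 0 := by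
  intro h
  have := one_le_norm_two_sub t
  rw [h, norm_zero] at this
  linarith

theorem norm_centredChar (t : ℝ) : ‖centredChar t‖ = 1 / ‖2 - Complex.exp (Complex.I * t)‖ := by
  rw [centredChar, one_sub_sq_eq, norm_div, norm_mul, norm_exp_I_mul, norm_one, one_mul]

theorem continuous_centredChar : Continuous centredChar := by
  unfold centredChar
  refine Continuous.div continuous_const (by fun_prop) fun t => ?_
  rw [one_sub_sq_eq]
  exact mul_ne_zero (Complex.exp_ne_zero _) (two_sub_exp_ne_zero t)

/-- Here `|2 - e^{it}|² = 1 + 4(1 - cos t) ≥ 1 + y` with `y = 8t²/π²`. As `y ≤ 8` on the range, `log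
(1 + y) ≥ y/(1 + y) ≥ y/9`, and `π² < 10` gives `y/9 ≥ 4t²/45 ≥ 2t²/25`. Taking the square root
halves the exponent to `t²/25`. -/
theorem norm_centredChar_le {t : ℝ} (ht : |t| ≤ Real.pi) :
    ‖centredChar t‖ ≤ Real.exp (-(1 / 25) * t ^ 2) := by
  have hsq : ‖2 - Complex.exp (Complex.I * t)‖ ^ 2 = 1 + 4 * (1 - Real.cos t) := by
    rw [← Complex.normSq_eq_norm_sq, Complex.normSq_apply, mul_comm Complex.I,
      Complex.sub_re, Complex.sub_im, Complex.exp_ofReal_mul_I_re, Complex.exp_ofReal_mul_I_im]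
    simp only [Complex.re_ofNat, Complex.im_ofNat]
    nlinarith [Real.sin_sq_add_cos_sq t]
  have hcos := Real.cos_le_one_sub_mul_cos_sq ht
  have hpi : Real.pi ^ 2 < 10 := by nlinarith [Real.pi_lt_d2, Real.pi_pos]
  have hpi0 := Real.pi_pos
  set y := 8 / Real.pi ^ 2 * t ^ 2 with hy
  have hy0 : 0 ≤ y := by positivity
  have hy8 : y ≤ 8 := by
    rw [hy, div_mul_eq_mul_div, div_le_iff₀ (by positivity)]
    have := sq_abs t
    nlinarith [abs_nonneg t]
  have hty : 4 / 5 * t ^ 2 ≤ y := by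
    rw [hy]
    refine mul_le_mul_of_nonneg_right ?_ (sq_nonneg t)
    rw [div_le_div_iff₀ (by norm_num) (by positivity)]
    linarith
  have h1 : 1 + y ≤ ‖2 - Complex.exp (Complex.I * t)‖ ^ 2 := by
    rw [hsq, hy]
    have : 8 / Real.pi ^ 2 * t ^ 2 = 4 * (2 / Real.pi ^ 2 * t ^ 2) := by ring
    linarith
  have hexp : Real.exp (2 / 25 * t ^ 2) ≤ 1 + y := by
    rw [← Real.le_log_iff_exp_le (by linarith)]
    have := Real.one_sub_inv_le_log_of_pos (show 0 < 1 + y by linarith)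
    have h2 : y / 9 ≤ 1 - (1 + y)⁻¹ := by
      rw [show 1 - (1 + y)⁻¹ = y / (1 + y) by field_simp; ring]
      exact div_le_div_of_nonneg_left hy0 (by linarith) (by linarith)
    nlinarith [sq_nonneg t]
  have h3 : Real.exp (1 / 25 * t ^ 2) ≤ ‖2 - Complex.exp (Complex.I * t)‖ := by
    refine le_of_sq_le_sq ?_ (norm_nonneg _)
    rw [← Real.exp_nat_mul]
    refine le_trans (le_of_eq ?_) (hexp.trans h1)
    congr 1
    push_cast
    ring
  rw [norm_centredChar, neg_mul, Real.exp_neg, ← one_div]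
  exact one_div_le_one_div_of_le (Real.exp_pos _) h3

-- Follows the chain `1/(1 - w²) ≈ 1 + w² ≈ 1 - t² ≈ e^{-t²}` with `w = e^{it} - 1`. The errors are
-- `t⁴`, `4|t|³` and `t⁴`; since `|t| ≤ π < 3.15`, the total is at most `10.3 |t|³`.
open Complex in
theorem norm_centredChar_sub_le {t : ℝ} (ht : |t| ≤ Real.pi) :
    ‖centredChar t - (Real.exp (-t ^ 2) : ℝ)‖ ≤ 11 * |t| ^ 3 := by
  set w := cexp (I * t) - 1 with hw
  have hwt : ‖w‖ ≤ |t| := Real.norm_exp_I_mul_ofReal_sub_one_le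
  have hIt : ‖I * (t : ℂ)‖ = |t| := by simp
  have hne : (1 : ℂ) - w ^ 2 ≠ 0 := by
    rw [hw, one_sub_sq_eq]
    exact mul_ne_zero (Complex.exp_ne_zero _) (two_sub_exp_ne_zero t)
  have h1 : ‖centredChar t - (1 + w ^ 2)‖ ≤ |t| ^ 4 := by
    have : centredChar t - (1 + w ^ 2) = w ^ 4 * centredChar t := by
      rw [centredChar, ← hw]; field_simp; ring
    rw [this, norm_mul, norm_pow, norm_centredChar]
    have h2 : 1 / ‖2 - cexp (I * t)‖ ≤ 1 := by
      rw [div_le_one (by linarith [one_le_norm_two_sub t])]; exact one_le_norm_two_sub t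
    calc ‖w‖ ^ 4 * (1 / ‖2 - cexp (I * t)‖) ≤ |t| ^ 4 * 1 := by gcongr
      _ = |t| ^ 4 := mul_one _
  have h2 : ‖w ^ 2 + (t : ℂ) ^ 2‖ ≤ 4 * |t| ^ 3 := by
    have : w ^ 2 + (t : ℂ) ^ 2 = (w - I * t) * (w + I * t) := by
      ring_nf; rw [I_sq]; ring
    rw [this, norm_mul]
    have h3 := norm_exp_I_sub_one_sub_le t
    rw [← hw] at h3
    have h4 := norm_add_le w (I * t)
    rw [hIt] at h4
    calc ‖w - I * t‖ * ‖w + I * t‖ ≤ (2 * t ^ 2) * (|t| + |t|) := by gcongr; linarith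
      _ = 4 * |t| ^ 3 := by rw [← sq_abs]; ring
  have h3 : |1 - t ^ 2 - Real.exp (-t ^ 2)| ≤ |t| ^ 4 := by
    have h4 : |t| ^ 4 = (t ^ 2) ^ 2 := by rw [← sq_abs t]; ring
    rw [h4]
    rcases le_or_gt (t ^ 2) 1 with h | h
    · have := Real.abs_exp_sub_one_sub_id_le (x := -t ^ 2) (by
        rw [abs_neg, abs_of_nonneg (sq_nonneg t)]; exact h)
      rw [neg_sq] at this
      rw [abs_sub_comm]
      convert this using 2
      ring
    · have h5 := Real.add_one_le_exp (-t ^ 2)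
      have h6 : Real.exp (-t ^ 2) ≤ 1 := Real.exp_le_one_iff.2 (by linarith)
      rw [abs_le]
      constructor <;> nlinarith
  have hsplit : centredChar t - (Real.exp (-t ^ 2) : ℝ) =
      (centredChar t - (1 + w ^ 2)) + (w ^ 2 + (t : ℂ) ^ 2) +
        ((1 - t ^ 2 - Real.exp (-t ^ 2) : ℝ) : ℂ) := by
    push_cast; ring
  rw [hsplit]
  refine (norm_add₃_le).trans ?_
  rw [norm_real, Real.norm_eq_abs]
  have h5 : |t| ^ 4 ≤ 3.15 * |t| ^ 3 := by
    rw [pow_succ, mul_comm]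
    gcongr
    linarith [Real.pi_lt_d2]
  have : 0 ≤ |t| ^ 3 := by positivity
  linarith

theorem norm_pow_sub_pow_le {a b : ℂ} {M : ℝ} (ha : ‖a‖ ≤ M) (hb : ‖b‖ ≤ M) (k : ℕ) :
    ‖a ^ (k + 1) - b ^ (k + 1)‖ ≤ (k + 1) * M ^ k * ‖a - b‖ := by
  have hM : 0 ≤ M := (norm_nonneg a).trans ha
  rw [← geom_sum₂_mul, norm_mul]
  gcongr
  refine (norm_sum_le _ _).trans ?_
  have : ∀ i ∈ Finset.range (k + 1), ‖a ^ i * b ^ (k + 1 - 1 - i)‖ ≤ M ^ k := by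
    intro i hi
    have hi := Finset.mem_range.1 hi
    rw [norm_mul, norm_pow, norm_pow]
    calc ‖a‖ ^ i * ‖b‖ ^ (k + 1 - 1 - i) ≤ M ^ i * M ^ (k + 1 - 1 - i) := by gcongr
      _ = M ^ k := by rw [← pow_add]; congr 1; omega
  refine (Finset.sum_le_sum this).trans ?_
  simp

/-- Telescoping the difference of powers leaves only `k - 1` decay factors. The missing one costs
`e^{t²/25} ≤ e ≤ 3`, whence `33 = 3 · 11`. -/
theorem norm_centredChar_pow_sub_le {t : ℝ} (ht : |t| ≤ Real.pi) {k : ℕ} (hk : 1 ≤ k) :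
    ‖centredChar t ^ k - (Real.exp (-k * t ^ 2) : ℝ)‖ ≤
      33 * k * (|t| ^ 3 * Real.exp (-(k / 25) * t ^ 2)) := by
  obtain ⟨k, rfl⟩ := Nat.exists_eq_add_of_le' hk
  have hb : ‖((Real.exp (-t ^ 2) : ℝ) : ℂ)‖ ≤ Real.exp (-(1 / 25) * t ^ 2) := by
    rw [Complex.norm_real, Real.norm_eq_abs, abs_of_pos (Real.exp_pos _), Real.exp_le_exp]
    nlinarith [sq_nonneg t]
  have h := norm_pow_sub_pow_le (norm_centredChar_le ht) hb k
  have he : (Real.exp (-((k + 1 : ℕ) : ℝ) * t ^ 2) : ℝ) = Real.exp (-t ^ 2) ^ (k + 1) := by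
    rw [← Real.exp_nat_mul]; congr 1; ring
  have hpi : t ^ 2 < 10 := by
    have := Real.pi_lt_d2
    have h1 := Real.pi_pos
    rw [← sq_abs]
    nlinarith [abs_nonneg t]
  have hM : Real.exp (-(1 / 25) * t ^ 2) ^ k ≤
      3 * Real.exp (-(((k + 1 : ℕ) : ℝ) / 25) * t ^ 2) := by
    have h3 : Real.exp 1 ≤ 3 := by linarith [Real.exp_one_lt_d9]
    calc Real.exp (-(1 / 25) * t ^ 2) ^ k
        = Real.exp (1 / 25 * t ^ 2) * Real.exp (-(((k + 1 : ℕ) : ℝ) / 25) * t ^ 2) := by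
          rw [← Real.exp_nat_mul, ← Real.exp_add]; congr 1; push_cast; ring
      _ ≤ Real.exp 1 * Real.exp (-(((k + 1 : ℕ) : ℝ) / 25) * t ^ 2) := by
          gcongr; linarith
      _ ≤ _ := by gcongr
  rw [he, Complex.ofReal_pow]
  calc _ ≤ ((k : ℝ) + 1) * Real.exp (-(1 / 25) * t ^ 2) ^ k *
        ‖centredChar t - (Real.exp (-t ^ 2) : ℝ)‖ := h
    _ ≤ ((k : ℝ) + 1) * (3 * Real.exp (-(((k + 1 : ℕ) : ℝ) / 25) * t ^ 2)) * (11 * |t| ^ 3) := by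
        gcongr
        exact norm_centredChar_sub_le ht
    _ = _ := by push_cast; ring

theorem integral_cube_mul_exp_le {a b : ℝ} (ha : 0 < a) (hb : 0 ≤ b) :
    ∫ t in -b..b, |t| ^ 3 * Real.exp (-a * t ^ 2) ≤ 1 / a ^ 2 := by
  have hc : Continuous fun t : ℝ => |t| ^ 3 * Real.exp (-a * t ^ 2) := by fun_prop
  have hhalf : ∫ t in (0 : ℝ)..b, |t| ^ 3 * Real.exp (-a * t ^ 2) ≤ 1 / (2 * a ^ 2) := by
    -- An explicit antiderivative on the half line; its value at `0` is the whole bound, the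
    -- endpoint `b` contributing with a favourable sign.
    have hderiv : ∀ t : ℝ, HasDerivAt
        (fun t => -(t ^ 2 / (2 * a) + 1 / (2 * a ^ 2)) * Real.exp (-a * t ^ 2))
        (t ^ 3 * Real.exp (-a * t ^ 2)) t := by
      intro t
      have h1 : HasDerivAt (fun t : ℝ => -(t ^ 2 / (2 * a) + 1 / (2 * a ^ 2))) (-(t / a)) t := by
        have := (((hasDerivAt_pow 2 t).div_const (2 * a)).add_const (1 / (2 * a ^ 2))).neg
        refine this.congr_deriv ?_
        field_simp
        norm_num
      have h2 : HasDerivAt (fun t : ℝ => Real.exp (-a * t ^ 2))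
          (Real.exp (-a * t ^ 2) * (-a * (2 * t))) t := by
        have := ((hasDerivAt_pow 2 t).const_mul (-a)).exp
        convert this using 1
        simp
      refine (h1.mul h2).congr_deriv ?_
      field_simp
      ring
    have h3 : ∫ t in (0 : ℝ)..b, |t| ^ 3 * Real.exp (-a * t ^ 2) =
        ∫ t in (0 : ℝ)..b, t ^ 3 * Real.exp (-a * t ^ 2) := by
      refine intervalIntegral.integral_congr fun t ht => ?_
      rw [Set.uIcc_of_le hb] at ht
      simp only [abs_of_nonneg ht.1]
    rw [h3, intervalIntegral.integral_eq_sub_of_hasDerivAt (fun t _ => hderiv t)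
      (Continuous.intervalIntegrable (by fun_prop) _ _)]
    simp only [ne_eq, OfNat.ofNat_ne_zero, not_false_eq_true, zero_pow, zero_div, zero_add,
      mul_zero, Real.exp_zero, mul_one, sub_neg_eq_add]
    have : 0 ≤ (b ^ 2 / (2 * a) + 1 / (2 * a ^ 2)) * Real.exp (-a * b ^ 2) := by positivity
    linarith
  have hneg : ∫ t in -b..0, |t| ^ 3 * Real.exp (-a * t ^ 2) =
      ∫ t in (0 : ℝ)..b, |t| ^ 3 * Real.exp (-a * t ^ 2) := by
    have := intervalIntegral.integral_comp_neg (a := 0) (b := b)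
      (fun t : ℝ => |t| ^ 3 * Real.exp (-a * t ^ 2))
    simp only [abs_neg, neg_sq, neg_zero] at this
    exact this.symm
  rw [← intervalIntegral.integral_add_adjacent_intervals (hc.intervalIntegrable (-b) 0)
    (hc.intervalIntegrable 0 b), hneg]
  calc _ ≤ 1 / (2 * a ^ 2) + 1 / (2 * a ^ 2) := add_le_add hhalf hhalf
    _ = 1 / a ^ 2 := by field_simp; norm_num

open Complex in
theorem integral_gaussian_mul_exp {k : ℝ} (hk : 0 < k) (x : ℝ) :
    ∫ t : ℝ, (Real.exp (-k * t ^ 2) : ℂ) * cexp (I * x * t) =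
      ((√(Real.pi / k) * Real.exp (-x ^ 2 / (4 * k)) : ℝ) : ℂ) := by
  have h := fourierIntegral_gaussian (b := k) (by simpa using hk) x
  calc _ = ∫ t : ℝ, cexp (I * x * t) * cexp (-k * t ^ 2) := by
        refine integral_congr_ae (Eventually.of_forall fun t => ?_)
        push_cast
        ring
    _ = _ := by
        rw [h]
        push_cast
        congr 1
        rw [Real.sqrt_eq_rpow, Complex.ofReal_cpow (by positivity)]
        push_cast
        rfl

-- Only the Gaussian tail outside `(-π, π]` is lost. There `t² ≥ 2`, so half of the exponent gives
-- `e^{-kt²/2} ≤ 1/k`, and the other half stays below the integrable `e^{-t²/2}`.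
open Complex in
theorem norm_integral_gaussian_sub_le {k : ℝ} (hk : 1 ≤ k) (x : ℝ) :
    ‖(∫ t in -Real.pi..Real.pi, (Real.exp (-k * t ^ 2) : ℂ) * cexp (I * x * t)) -
      ((√(Real.pi / k) * Real.exp (-x ^ 2 / (4 * k)) : ℝ) : ℂ)‖ ≤ √(2 * Real.pi) / k := by
  have hk0 : 0 < k := by linarith
  have hnorm : ∀ t : ℝ, ‖(Real.exp (-k * t ^ 2) : ℂ) * cexp (I * x * t)‖ =
      Real.exp (-k * t ^ 2) := by
    intro t
    rw [norm_mul, norm_real, Real.norm_eq_abs, abs_of_pos (Real.exp_pos _), mul_assoc,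
      ← ofReal_mul, norm_exp_I_mul, mul_one]
  have hint : Integrable fun t : ℝ => (Real.exp (-k * t ^ 2) : ℂ) * cexp (I * x * t) := by
    rw [← integrable_norm_iff (by fun_prop)]
    simp only [hnorm]
    exact integrable_exp_neg_mul_sq hk0
  rw [← integral_gaussian_mul_exp hk0, intervalIntegral.integral_of_le (by linarith [Real.pi_pos]),
    ← integral_add_compl measurableSet_Ioc hint, sub_add_cancel_left, norm_neg]
  have hbound : ∀ t ∈ (Set.Ioc (-Real.pi) Real.pi)ᶜ,
      ‖(Real.exp (-k * t ^ 2) : ℂ) * cexp (I * x * t)‖ ≤ 1 / k * Real.exp (-(1 / 2) * t ^ 2) := by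
    intro t ht
    have ht2 : 2 ≤ t ^ 2 := by
      have h3 := Real.pi_gt_three
      rw [Set.mem_compl_iff, Set.mem_Ioc, not_and_or, not_lt, not_le] at ht
      rcases ht with h | h <;> nlinarith
    rw [hnorm, show -k * t ^ 2 = -(k * t ^ 2 / 2) + -(k * t ^ 2 / 2) by ring, Real.exp_add]
    gcongr
    · rw [Real.exp_neg, ← one_div]
      refine one_div_le_one_div_of_le hk0 ?_
      have := Real.add_one_le_exp (k * t ^ 2 / 2)
      nlinarith
    · nlinarith
  have hint2 : Integrable fun t : ℝ => 1 / k * Real.exp (-(1 / 2) * t ^ 2) :=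
    (integrable_exp_neg_mul_sq (by norm_num)).const_mul _
  calc ‖∫ t in (Set.Ioc (-Real.pi) Real.pi)ᶜ, (Real.exp (-k * t ^ 2) : ℂ) * cexp (I * x * t)‖
      ≤ ∫ t in (Set.Ioc (-Real.pi) Real.pi)ᶜ, 1 / k * Real.exp (-(1 / 2) * t ^ 2) :=
        norm_integral_le_of_norm_le hint2.integrableOn
          ((ae_restrict_iff' measurableSet_Ioc.compl).2 (Eventually.of_forall hbound))
    _ ≤ ∫ t : ℝ, 1 / k * Real.exp (-(1 / 2) * t ^ 2) :=
        setIntegral_le_integral hint2 (Eventually.of_forall fun t => by positivity)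
    _ = √(2 * Real.pi) / k := by
        rw [integral_const_mul, integral_gaussian, div_div_eq_mul_div, div_one, mul_comm Real.pi]
        ring

open Complex in
theorem integral_exp_I_int_mul (m : ℤ) :
    ∫ t in -Real.pi..Real.pi, cexp (I * m * t) = if m = 0 then 2 * (Real.pi : ℂ) else 0 := by
  split_ifs with h
  · subst h
    simp
    ring
  · have hm : (I * m : ℂ) ≠ 0 := mul_ne_zero I_ne_zero (by exact_mod_cast h)
    rw [integral_exp_mul_complex hm]
    have : cexp (I * m * (Real.pi : ℝ)) = cexp (I * m * ((-Real.pi : ℝ) : ℂ)) := by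
      rw [Complex.exp_eq_exp_iff_exists_int]
      exact ⟨m, by push_cast; ring⟩
    rw [this, sub_self, zero_div]

open Complex in
/-- Fourier inversion for integer-valued random variables. -/
theorem two_pi_mul_real_eq_integral {Ω : Type*} [MeasurableSpace Ω] {P : Measure Ω}
    [IsProbabilityMeasure P] {Y : Ω → ℤ} (hY : Measurable Y) (n : ℤ) :
    ((2 * Real.pi * P.real {ω | Y ω = n} : ℝ) : ℂ) =
      ∫ t in -Real.pi..Real.pi, ∫ ω, cexp (I * ((Y ω - n : ℤ) : ℂ) * t) ∂P := by
  have hle : -Real.pi ≤ Real.pi := by linarith [Real.pi_pos]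
  have hmeas : Measurable fun p : ℝ × Ω => cexp (I * ((Y p.2 - n : ℤ) : ℂ) * p.1) := by
    have h1 : Measurable fun p : ℝ × Ω => ((Y p.2 - n : ℤ) : ℂ) :=
      (measurable_from_top (f := fun m : ℤ => ((m - n : ℤ) : ℂ))).comp (hY.comp measurable_snd)
    have h2 : Measurable fun p : ℝ × Ω => (p.1 : ℂ) :=
      Complex.measurable_ofReal.comp measurable_fst
    exact Complex.measurable_exp.comp ((h1.const_mul I).mul h2)
  have hint : Integrable (Function.uncurry fun (t : ℝ) ω => cexp (I * ((Y ω - n : ℤ) : ℂ) * t))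
      ((volume.restrict (Set.Ioc (-Real.pi) Real.pi)).prod P) := by
    refine Integrable.of_bound hmeas.aestronglyMeasurable 1 (Eventually.of_forall fun p => ?_)
    simp only [Function.uncurry]
    have := norm_exp_I_mul (((Y p.2 - n : ℤ) : ℝ) * p.1)
    push_cast at this ⊢
    rw [mul_assoc, this]
  rw [intervalIntegral.integral_of_le hle, integral_integral_swap hint]
  have h3 : ∀ ω, ∫ t in Set.Ioc (-Real.pi) Real.pi, cexp (I * ((Y ω - n : ℤ) : ℂ) * t) =
      {ω | Y ω = n}.indicator (fun _ => 2 * (Real.pi : ℂ)) ω := by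
    intro ω
    rw [← intervalIntegral.integral_of_le hle, integral_exp_I_int_mul]
    simp [Set.indicator, sub_eq_zero]
  simp_rw [h3]
  have hn : MeasurableSet {ω | Y ω = n} := hY (measurableSet_singleton n)
  rw [integral_indicator_const _ hn, Complex.real_smul]
  push_cast
  ring

end FourierBounds

/-! ### Local limit theorem with rate -/

namespace IsGeometricSeq

variable {Ω : Type*} [MeasurableSpace Ω] {P : Measure Ω} {X : ℕ → Ω → ℕ}

open Complex in
theorem two_pi_mul_real_sum_eq (hX : IsGeometricSeq X P) (s : Finset ℕ) (n : ℤ) :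
    ((2 * Real.pi * P.real {ω | ((∑ i ∈ s, X i ω : ℕ) : ℤ) = n} : ℝ) : ℂ) =
      ∫ t in -Real.pi..Real.pi,
        centredChar t ^ s.card * cexp (I * ((2 * s.card - n : ℝ) : ℂ) * t) := by
  have := hX.isProbabilityMeasure
  have hm : Measurable fun ω => ((∑ i ∈ s, X i ω : ℕ) : ℤ) :=
    (measurable_from_top (f := fun m : ℕ => (m : ℤ))).comp (hX.measurable_sum s)
  rw [two_pi_mul_real_eq_integral hm]
  refine intervalIntegral.integral_congr fun t _ => ?_
  have h1 : ∀ ω, cexp (I * (((∑ i ∈ s, X i ω : ℕ) - n : ℤ) : ℂ) * t) =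
      cexp (I * t) ^ (∑ i ∈ s, X i ω) * cexp (-(I * n * t)) := by
    intro ω
    rw [← Complex.exp_nat_mul, ← Complex.exp_add]
    congr 1
    push_cast
    ring
  simp_rw [h1]
  rw [integral_mul_const, hX.integral_pow_sum s (by rw [norm_exp_I_mul]; norm_num)]
  have h2 : cexp (I * t) / (2 - cexp (I * t)) = centredChar t * cexp (2 * (I * t)) := by
    rw [centredChar, one_sub_sq_eq, two_mul, Complex.exp_add]
    have := two_sub_exp_ne_zero t
    have := Complex.exp_ne_zero (I * t)
    field_simp
  rw [h2, mul_pow, mul_assoc, ← Complex.exp_nat_mul, ← Complex.exp_add]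
  congr 2
  push_cast
  ring

/-- Local limit theorem with rate for sums of independent geometric variables. -/
theorem exists_local_limit_bound : ∃ C : ℝ, 0 ≤ C ∧
    ∀ {Ω : Type*} [MeasurableSpace Ω] {P : Measure Ω} {X : ℕ → Ω → ℕ}, IsGeometricSeq X P →
      ∀ s : Finset ℕ, s.Nonempty → ∀ n : ℤ,
        |√s.card * P.real {ω | ((∑ i ∈ s, X i ω : ℕ) : ℤ) = n} -
          1 / (2 * √Real.pi) * Real.exp (-((n : ℝ) - 2 * s.card) ^ 2 / (4 * s.card))| ≤
            C / √s.card := by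
  -- `33 * 625` is `33k · (25/k)²` up to the factor `1/k`, from the cubic integral with `a = k/25`;
  -- `√(2π)` is the Gaussian tail; `2π` is the normalization of Fourier inversion.
  refine ⟨(33 * 625 + √(2 * Real.pi)) / (2 * Real.pi), by positivity, ?_⟩
  intro Ω _ P X hX s hs n
  set k := s.card with hk
  have hk1 : 1 ≤ k := hs.card_pos
  have hkR : (1 : ℝ) ≤ k := by exact_mod_cast hk1
  have hk0 : (0 : ℝ) < k := by linarith
  have hpi := Real.pi_pos
  set p := P.real {ω | ((∑ i ∈ s, X i ω : ℕ) : ℤ) = n} with hp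
  set x : ℝ := 2 * k - n with hx
  have h1 := hX.two_pi_mul_real_sum_eq s n
  rw [← hk, ← hp, ← hx] at h1
  have h2 := norm_integral_gaussian_sub_le hkR x
  have hc1 : Continuous fun t : ℝ => centredChar t ^ k * Complex.exp (Complex.I * x * t) :=
    (continuous_centredChar.pow k).mul (by fun_prop)
  have hc2 : Continuous fun t : ℝ =>
      (Real.exp (-k * t ^ 2) : ℂ) * Complex.exp (Complex.I * x * t) := by fun_prop
  have h3 : ‖(∫ t in -Real.pi..Real.pi, centredChar t ^ k * Complex.exp (Complex.I * x * t)) -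
      ∫ t in -Real.pi..Real.pi, (Real.exp (-k * t ^ 2) : ℂ) * Complex.exp (Complex.I * x * t)‖ ≤
      33 * 625 / k := by
    rw [← intervalIntegral.integral_sub (hc1.intervalIntegrable _ _) (hc2.intervalIntegrable _ _)]
    have hle : -Real.pi ≤ Real.pi := by linarith
    have hb : ∀ t ∈ Set.Ioc (-Real.pi) Real.pi,
        ‖centredChar t ^ k * Complex.exp (Complex.I * x * t) -
          (Real.exp (-k * t ^ 2) : ℂ) * Complex.exp (Complex.I * x * t)‖ ≤
        33 * k * (|t| ^ 3 * Real.exp (-(k / 25) * t ^ 2)) := by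
      intro t ht
      rw [← sub_mul, norm_mul, mul_assoc Complex.I, ← Complex.ofReal_mul, norm_exp_I_mul, mul_one]
      exact norm_centredChar_pow_sub_le (abs_le.2 ⟨ht.1.le, ht.2⟩) hk1
    have hci : Continuous fun t : ℝ => 33 * (k : ℝ) * (|t| ^ 3 * Real.exp (-(k / 25) * t ^ 2)) := by
      fun_prop
    refine (intervalIntegral.norm_integral_le_of_norm_le hle (Eventually.of_forall hb)
      (hci.intervalIntegrable _ _)).trans ?_
    rw [intervalIntegral.integral_const_mul]
    have h4 := integral_cube_mul_exp_le (a := (k : ℝ) / 25) (b := Real.pi) (by positivity) hpi.le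
    calc _ ≤ 33 * (k : ℝ) * (1 / ((k : ℝ) / 25) ^ 2) := by gcongr
      _ = _ := by field_simp; norm_num
  have h5 : |2 * Real.pi * p - √(Real.pi / k) * Real.exp (-x ^ 2 / (4 * k))| ≤
      (33 * 625 + √(2 * Real.pi)) / k := by
    rw [← Real.norm_eq_abs, ← Complex.norm_real, Complex.ofReal_sub, h1, add_div]
    refine (norm_sub_le_norm_sub_add_norm_sub _ _ _).trans (add_le_add h3 h2)
  have hsk : 0 < √(k : ℝ) := Real.sqrt_pos.2 hk0
  have hsp : 0 < √Real.pi := Real.sqrt_pos.2 hpi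
  have h6 : √(k : ℝ) * p - 1 / (2 * √Real.pi) * Real.exp (-((n : ℝ) - 2 * k) ^ 2 / (4 * k)) =
      √(k : ℝ) / (2 * Real.pi) *
        (2 * Real.pi * p - √(Real.pi / k) * Real.exp (-x ^ 2 / (4 * k))) := by
    rw [Real.sqrt_div hpi.le, hx, show ((n : ℝ) - 2 * k) ^ 2 = (2 * k - n) ^ 2 by ring]
    have h7 : √Real.pi * √Real.pi = Real.pi := Real.mul_self_sqrt hpi.le
    generalize √Real.pi = q at h7 hsp
    rw [← h7]
    field_simp
  rw [h6, abs_mul, abs_of_pos (by positivity)]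
  calc _ ≤ √(k : ℝ) / (2 * Real.pi) * ((33 * 625 + √(2 * Real.pi)) / k) := by gcongr
    _ = _ := by
      have h7 : (k : ℝ) = √k * √k := (Real.mul_self_sqrt hk0.le).symm
      rw [h7, Real.sqrt_mul_self hsk.le]
      field_simp

end IsGeometricSeq

/-! ### Almost sure limits superior, and the growth of the gaps -/

/-- Countably many levels suffice, so that null sets can be united later. The shift `m + 2` keeps
the lower levels strictly positive, and working in `EReal` spares any boundedness condition. -/
theorem limsup_coe_eq_one_of_bounds {u : ℕ → ℝ}
    (h1 : ∀ m : ℕ, ∀ᶠ k in atTop, u k ≤ 1 + 1 / ((m : ℝ) + 1))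
    (h2 : ∀ m : ℕ, ∃ᶠ k in atTop, 1 - 1 / ((m : ℝ) + 2) ≤ u k) :
    limsup (fun k => (u k : EReal)) atTop = 1 := by
  have hlim : Tendsto (fun m : ℕ => 1 / ((m : ℝ) + 1)) atTop (𝓝 0) :=
    tendsto_one_div_add_atTop_nhds_zero_nat
  refine le_antisymm ?_ ?_
  · have ht : Tendsto (fun m : ℕ => ((1 + 1 / ((m : ℝ) + 1) : ℝ) : EReal)) atTop (𝓝 1) := by
      have : Tendsto (fun m : ℕ => 1 + 1 / ((m : ℝ) + 1)) atTop (𝓝 1) := by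
        simpa using hlim.const_add 1
      exact (continuous_coe_real_ereal.tendsto 1).comp this
    refine ge_of_tendsto' ht fun m => ?_
    refine limsup_le_of_le (h := ?_)
    filter_upwards [h1 m] with k hk
    exact_mod_cast hk
  · have ht : Tendsto (fun m : ℕ => ((1 - 1 / ((m : ℝ) + 2) : ℝ) : EReal)) atTop (𝓝 1) := by
      have : Tendsto (fun m : ℕ => 1 - 1 / ((m : ℝ) + 2)) atTop (𝓝 1) := by
        have h3 := ((tendsto_add_atTop_iff_nat 1).2 hlim).const_sub 1
        simp only [sub_zero] at h3
        refine h3.congr fun m => ?_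
        push_cast
        rw [add_assoc]; norm_num
      exact (continuous_coe_real_ereal.tendsto 1).comp this
    refine le_of_tendsto' ht fun m => ?_
    refine le_limsup_of_frequently_le ?_
    exact (h2 m).mono fun k hk => by exact_mod_cast hk

/-- An almost sure limit superior equals one if it is almost surely at most every `ρ > 1` and at
least every `ρ ∈ (0, 1)`. -/
theorem ae_limsup_coe_eq_one {Ω : Type*} [MeasurableSpace Ω] {P : Measure Ω} {u : ℕ → Ω → ℝ}
    (h1 : ∀ ρ : ℝ, 1 < ρ → ∀ᵐ ω ∂P, ∀ᶠ k in atTop, u k ω ≤ ρ)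
    (h2 : ∀ ρ : ℝ, 0 < ρ → ρ < 1 → ∀ᵐ ω ∂P, ∃ᶠ k in atTop, ρ ≤ u k ω) :
    ∀ᵐ ω ∂P, limsup (fun k => (u k ω : EReal)) atTop = 1 := by
  have h1' := ae_all_iff.2 fun m : ℕ => h1 (1 + 1 / ((m : ℝ) + 1)) (by
    have : (0 : ℝ) < 1 / ((m : ℝ) + 1) := by positivity
    linarith)
  have h2' := ae_all_iff.2 fun m : ℕ => h2 (1 - 1 / ((m : ℝ) + 2)) (by
    rw [sub_pos, div_lt_one (by positivity)]; linarith [(m.cast_nonneg : (0 : ℝ) ≤ m)]) (by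
    have : (0 : ℝ) < 1 / ((m : ℝ) + 2) := by positivity
    linarith)
  filter_upwards [h1', h2'] with ω a b
  exact limsup_coe_eq_one_of_bounds a b

namespace IsGeometricSeq

variable {Ω : Type*} [MeasurableSpace Ω] {P : Measure Ω} {X : ℕ → Ω → ℕ}

theorem half_pow_floor_bounds {x : ℝ} (hx : 0 ≤ x) :
    (2 : ℝ) ^ (-x) ≤ (1 / 2) ^ ⌊x⌋₊ ∧ (1 / 2 : ℝ) ^ ⌊x⌋₊ ≤ 2 * 2 ^ (-x) := by
  have h : (1 / 2 : ℝ) ^ ⌊x⌋₊ = 2 ^ (-(⌊x⌋₊ : ℝ)) := by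
    rw [Real.rpow_neg (by norm_num), Real.rpow_natCast, one_div, inv_pow]
  rw [h]
  constructor
  · exact Real.rpow_le_rpow_of_exponent_le (by norm_num) (neg_le_neg (Nat.floor_le hx))
  · calc (2 : ℝ) ^ (-(⌊x⌋₊ : ℝ)) ≤ 2 ^ (1 + -x) :=
        Real.rpow_le_rpow_of_exponent_le (by norm_num) (by linarith [Nat.lt_floor_add_one x])
      _ = 2 * 2 ^ (-x) := by rw [Real.rpow_add (by norm_num), Real.rpow_one]

/-- The probability of exceeding `⌊ρ log₂ (i + 1)⌋` is `(i + 1)^{-ρ}` up to a factor `2`: summable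
for `ρ > 1`. At `ρ = 1` the series already diverges, which settles every smaller level at once. -/
theorem ae_limsup_div_logb (hX : IsGeometricSeq X P) :
    ∀ᵐ ω ∂P, limsup (fun i : ℕ => (((X i ω : ℝ) / Real.logb 2 ((i + 1 : ℕ) : ℝ) : ℝ) : EReal))
      atTop = 1 := by
  have := hX.isProbabilityMeasure
  have hlog : ∀ i : ℕ, 0 ≤ Real.logb 2 ((i + 1 : ℕ) : ℝ) := fun i =>
    Real.logb_nonneg (by norm_num) (by push_cast; linarith [(i.cast_nonneg : (0 : ℝ) ≤ i)])
  have hlogpos : ∀ᶠ i : ℕ in atTop, 0 < Real.logb 2 ((i + 1 : ℕ) : ℝ) := by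
    filter_upwards [eventually_ge_atTop 1] with i hi
    exact Real.logb_pos (by norm_num) (by exact_mod_cast (by omega : 1 < i + 1))
  have hpow : ∀ (ρ : ℝ) (i : ℕ),
      (2 : ℝ) ^ (-(ρ * Real.logb 2 ((i + 1 : ℕ) : ℝ))) = ((i + 1 : ℕ) : ℝ) ^ (-ρ) := by
    intro ρ i
    rw [show -(ρ * Real.logb 2 ((i + 1 : ℕ) : ℝ)) = Real.logb 2 ((i + 1 : ℕ) : ℝ) * -ρ by ring,
      Real.rpow_mul (by norm_num), Real.rpow_logb (by norm_num) (by norm_num) (by positivity)]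
  refine ae_limsup_coe_eq_one (fun ρ hρ => ?_) fun ρ _ hρ => ?_
  · have hs : Summable fun i : ℕ =>
        P.real {ω | ⌊ρ * Real.logb 2 ((i + 1 : ℕ) : ℝ)⌋₊ < X i ω} := by
      have h1 : Summable fun i : ℕ => 2 * ((i + 1 : ℕ) : ℝ) ^ (-ρ) :=
        ((summable_nat_add_iff 1).2 (Real.summable_nat_rpow.2 (by linarith))).mul_left 2
      refine Summable.of_nonneg_of_le (fun _ => measureReal_nonneg) (fun i => ?_) h1
      rw [hX.real_lt_eq, ← hpow]
      exact (half_pow_floor_bounds (mul_nonneg (by linarith) (hlog i))).2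
    filter_upwards [ae_eventually_not_of_summable hs] with ω hω
    filter_upwards [hω, hlogpos] with i hi hpos
    rw [div_le_iff₀ hpos]
    exact (Nat.le_floor_iff (mul_nonneg (by linarith) (hlog i))).1 (not_lt.1 hi)
  · have hns : ¬ Summable fun i : ℕ =>
        P.real {ω | X i ω ∈ Set.Ioi ⌊Real.logb 2 ((i + 1 : ℕ) : ℝ)⌋₊} := by
      intro h
      have h1 : Summable fun i : ℕ => ((i + 1 : ℕ) : ℝ) ^ (-1 : ℝ) := by
        refine Summable.of_nonneg_of_le (fun i => by positivity) (fun i => ?_) h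
        simp only [Set.mem_Ioi]
        rw [hX.real_lt_eq, ← hpow, one_mul]
        exact (half_pow_floor_bounds (hlog i)).1
      have h2 := (summable_nat_add_iff (f := fun n : ℕ => (n : ℝ) ^ (-1 : ℝ)) 1).1 h1
      exact absurd (Real.summable_nat_rpow.1 h2) (by norm_num)
    filter_upwards [ae_frequently_mem_of_not_summable hX.measurable hX.indep
      (fun _ => MeasurableSet.of_discrete) hns] with ω hω
    refine (hω.and_eventually hlogpos).mono fun i hi => ?_
    rw [le_div_iff₀ hi.2]
    have := (Nat.floor_lt (hlog i)).1 hi.1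
    nlinarith [hi.2]

end IsGeometricSeq

/-! ### Exponential moments and the upper half of the iterated logarithm -/

/-- Second order behaviour at zero of the cumulant generating function of a centred geometric
variable. -/
theorem exists_one_div_one_sub_sq_le {ρ : ℝ} (hρ : 1 < ρ) :
    ∃ l₀ : ℝ, 0 < l₀ ∧ ∀ l : ℝ, 0 ≤ l → l ≤ l₀ →
      Real.exp l < 2 ∧ 1 / (1 - (Real.exp l - 1) ^ 2) ≤ Real.exp (ρ * l ^ 2) := by
  -- With `v = e^l - 1 ≤ l(1 + l)`, the bound `-log (1 - v²) ≤ v²/(1 - v²)` gives at most `l²` times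
  -- this function. It equals `1 < ρ` at `0`, so continuity provides `l₀`.
  have hc : ContinuousAt (fun l : ℝ => (1 + l) ^ 2 / (1 - l ^ 2 * (1 + l) ^ 2)) 0 := by
    refine ContinuousAt.div (by fun_prop) (by fun_prop) (by norm_num)
  have h1 : ∀ᶠ l : ℝ in 𝓝 0, (1 + l) ^ 2 / (1 - l ^ 2 * (1 + l) ^ 2) < ρ :=
    hc.eventually_lt_const (by simpa using hρ)
  obtain ⟨r, hr, h2⟩ := Metric.eventually_nhds_iff.1 h1
  refine ⟨min (1 / 2) (r / 2), by positivity, fun l hl0 hl => ?_⟩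
  have hl1 : l ≤ 1 / 2 := hl.trans (min_le_left _ _)
  have hlr : l < r := lt_of_le_of_lt (hl.trans (min_le_right _ _)) (by linarith)
  have h3 := h2 (y := l) (by rwa [Real.dist_eq, sub_zero, abs_of_nonneg hl0])
  set v := Real.exp l - 1 with hv
  have hv0 : 0 ≤ v := by linarith [Real.add_one_le_exp l]
  have hvl : v ≤ l * (1 + l) := by
    have := Real.abs_exp_sub_one_sub_id_le (x := l) (by rw [abs_of_nonneg hl0]; linarith)
    have := (abs_le.1 this).2
    nlinarith
  have hb : l * (1 + l) ≤ 3 / 4 := by nlinarith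
  have hw : v ^ 2 ≤ l ^ 2 * (1 + l) ^ 2 := by rw [← mul_pow]; gcongr
  have hw1 : l ^ 2 * (1 + l) ^ 2 ≤ 9 / 16 := by
    rw [← mul_pow]
    have : 0 ≤ l * (1 + l) := by positivity
    nlinarith
  refine ⟨by linarith, ?_⟩
  have hd : 0 < 1 - v ^ 2 := by linarith
  rw [← Real.log_le_iff_le_exp (by positivity), one_div, Real.log_inv]
  have h4 := Real.one_sub_inv_le_log_of_pos hd
  have h5 : (1 - v ^ 2)⁻¹ - 1 ≤ ρ * l ^ 2 := by
    have h6 : (1 - v ^ 2)⁻¹ - 1 = v ^ 2 / (1 - v ^ 2) := by field_simp; ring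
    rw [h6]
    calc v ^ 2 / (1 - v ^ 2) ≤ l ^ 2 * (1 + l) ^ 2 / (1 - l ^ 2 * (1 + l) ^ 2) := by
          gcongr
          linarith
      _ = (1 + l) ^ 2 / (1 - l ^ 2 * (1 + l) ^ 2) * l ^ 2 := by ring
      _ ≤ ρ * l ^ 2 := by gcongr
  linarith

namespace IsGeometricSeq

variable {Ω : Type*} [MeasurableSpace Ω] {P : Measure Ω} {X : ℕ → Ω → ℕ}

theorem integrable_exp_and_integral (hX : IsGeometricSeq X P) (i : ℕ) {l : ℝ}
    (hl : Real.exp l < 2) :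
    Integrable (fun ω => Real.exp (l * ((X i ω : ℝ) - 2))) P ∧
      ∫ ω, Real.exp (l * ((X i ω : ℝ) - 2)) ∂P = 1 / (1 - (Real.exp l - 1) ^ 2) := by
  have h := hX.integrable_pow_and_integral i (z := Real.exp l)
    (by rwa [Real.norm_eq_abs, abs_of_pos (Real.exp_pos l)])
  have heq : (fun ω => Real.exp (l * ((X i ω : ℝ) - 2))) =
      fun ω => Real.exp (-(2 * l)) * Real.exp l ^ X i ω := by
    funext ω
    rw [← Real.exp_nat_mul, ← Real.exp_add]
    congr 1
    ring
  rw [heq]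
  refine ⟨h.1.const_mul _, ?_⟩
  rw [integral_const_mul, h.2, two_mul, neg_add, Real.exp_add, Real.exp_neg]
  have h1 := Real.exp_pos l
  have h2 : 2 - Real.exp l ≠ 0 := by linarith
  have h3 : 1 - (Real.exp l - 1) ^ 2 = Real.exp l * (2 - Real.exp l) := by ring
  rw [h3]
  field_simp

/-- Exponential maximal inequality for the centred partial sums. -/
theorem real_exists_le_sum_le (hX : IsGeometricSeq X P) {l x : ℝ} (hl : 0 ≤ l)
    (hl2 : Real.exp l < 2) (N : ℕ) :
    P.real {ω | ∃ k, 1 ≤ k ∧ k ≤ N ∧ x ≤ ∑ i ∈ Finset.range k, (X i ω : ℝ) - 2 * k} ≤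
      Real.exp (-(l * x)) * (1 / (1 - (Real.exp l - 1) ^ 2)) ^ N := by
  have := hX.isProbabilityMeasure
  rcases N with _ | N
  · have : {ω | ∃ k, 1 ≤ k ∧ k ≤ 0 ∧ x ≤ ∑ i ∈ Finset.range k, (X i ω : ℝ) - 2 * k} = ∅ := by
      ext ω
      simp only [Set.mem_ofPred_eq, Set.mem_empty_iff_false, iff_false]
      rintro ⟨k, h1, h2, _⟩
      omega
    rw [this, measureReal_empty]
    positivity
  set m := 1 / (1 - (Real.exp l - 1) ^ 2) with hm
  have hm1 : 1 ≤ m := by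
    have h0 : 0 ≤ Real.exp l - 1 := by linarith [Real.add_one_le_exp l]
    have h1 : 0 < 1 - (Real.exp l - 1) ^ 2 := by nlinarith
    rw [hm, le_div_iff₀ h1]
    nlinarith
  set Z : ℕ → Ω → ℝ := fun i ω => Real.exp (l * ((X i ω : ℝ) - 2)) with hZ
  have hg : Measurable fun n : ℕ => Real.exp (l * ((n : ℝ) - 2)) := by fun_prop
  have hZm : ∀ i, Measurable (Z i) := fun i => hg.comp (hX.measurable i)
  have hZs : ∀ i, StronglyMeasurable (Z i) := fun i => (hZm i).stronglyMeasurable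
  have hZi : iIndepFun Z P := hX.indep.comp (fun _ n => Real.exp (l * ((n : ℝ) - 2))) fun _ => hg
  have hZint : ∀ i, Integrable (Z i) P := fun i => (hX.integrable_exp_and_integral i hl2).1
  have hZE : ∀ i, ∫ ω, Z i ω ∂P = m := fun i => (hX.integrable_exp_and_integral i hl2).2
  set M : ℕ → Ω → ℝ := fun n => ∏ i ∈ Finset.range (n + 1), Z i with hM
  have hMsucc : ∀ n, M (n + 1) = M n * Z (n + 1) := fun n => Finset.prod_range_succ _ _
  have hMind : ∀ n, IndepFun (M n) (Z (n + 1)) P := fun n =>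
    hZi.indepFun_prod_range_succ hZm (n + 1)
  have hMZ : ∀ n, Integrable (M n) P ∧ ∫ ω, M n ω ∂P = m ^ (n + 1) := by
    intro n
    induction n with
    | zero =>
      have : M 0 = Z 0 := by rw [hM]; simp
      rw [this]
      exact ⟨hZint 0, by rw [hZE]; ring⟩
    | succ n ih =>
      rw [hMsucc]
      refine ⟨(hMind n).integrable_mul ih.1 (hZint _), ?_⟩
      rw [(hMind n).integral_mul_eq_mul_integral ih.1.aestronglyMeasurable
        (hZint _).aestronglyMeasurable, ih.2, hZE]
      ring
  set 𝓕 := Filtration.natural Z hZs with hF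
  have hadZ : StronglyAdapted 𝓕 Z := Filtration.stronglyAdapted_natural hZs
  have hadp : StronglyAdapted 𝓕 M := by
    intro n
    exact Finset.stronglyMeasurable_prod _ fun i hi =>
      (hadZ i).mono (𝓕.mono (Nat.lt_succ_iff.1 (Finset.mem_range.1 hi)))
  have hM0 : 0 ≤ M := by
    intro n ω
    simp only [hM, Finset.prod_apply, Pi.zero_apply]
    exact Finset.prod_nonneg fun i _ => (Real.exp_pos _).le
  -- The product is not normalized: each factor has mean `m ≥ 1`, which makes it a submartingale, as
  -- Doob's inequality requires. `M n` has `n + 1` factors.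
  have hsub : Submartingale M 𝓕 P := by
    refine submartingale_nat hadp (fun n => (hMZ n).1) fun n => ?_
    have h1 := condExp_mul_of_stronglyMeasurable_left (μ := P) (hadp n)
      (by rw [← hMsucc]; exact (hMZ (n + 1)).1) (hZint (n + 1))
    have h2 := hZi.condExp_natural_ae_eq_of_lt hZs n.lt_succ_self
    rw [hMsucc]
    filter_upwards [h1, h2] with ω h1 h2
    rw [h1, Pi.mul_apply, h2, hZE]
    exact le_mul_of_one_le_right (hM0 n ω) hm1
  have hmax := maximal_ineq hsub hM0 (ε := (Real.exp (l * x)).toNNReal) N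
  have hMexp : ∀ k ω, M k ω =
      Real.exp (l * (∑ i ∈ Finset.range (k + 1), (X i ω : ℝ) - 2 * ((k + 1 : ℕ) : ℝ))) := by
    intro k ω
    simp only [hM, hZ, Finset.prod_apply]
    rw [← Real.exp_sum, ← Finset.mul_sum, Finset.sum_sub_distrib]
    simp [mul_comm]
  have hle : ENNReal.ofReal (Real.exp (l * x)) *
      P {ω | ∃ k, 1 ≤ k ∧ k ≤ N + 1 ∧ x ≤ ∑ i ∈ Finset.range k, (X i ω : ℝ) - 2 * k} ≤
      ENNReal.ofReal (m ^ (N + 1)) := by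
    rw [← (hMZ N).2]
    refine le_trans ?_ (hmax.trans ?_)
    · rw [ENNReal.ofReal]
      gcongr
      rintro ⟨k, hk1, hkN, hk⟩
      obtain ⟨k, rfl⟩ := Nat.exists_eq_add_of_le' hk1
      rw [Finset.le_sup'_iff]
      refine ⟨k, Finset.mem_range.2 (by omega), ?_⟩
      rw [hMexp, Real.coe_toNNReal _ (Real.exp_pos _).le]
      exact Real.exp_le_exp.2 (mul_le_mul_of_nonneg_left hk hl)
    · exact ENNReal.ofReal_le_ofReal (setIntegral_le_integral (hMZ N).1
        (Eventually.of_forall fun ω => hM0 N ω))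
  have hreal := ENNReal.toReal_mono ENNReal.ofReal_ne_top hle
  rw [ENNReal.toReal_mul, ENNReal.toReal_ofReal (Real.exp_pos _).le,
    ENNReal.toReal_ofReal (by positivity), ← measureReal_def] at hreal
  rw [Real.exp_neg, ← div_eq_inv_mul, le_div_iff₀ (Real.exp_pos _), mul_comm]
  exact hreal

/-- Upper half of the law of the iterated logarithm. -/
theorem ae_eventually_sum_le (hX : IsGeometricSeq X P) {ρ : ℝ} (hρ : 1 < ρ) :
    ∀ᵐ ω ∂P, ∀ᶠ k : ℕ in atTop, ∑ i ∈ Finset.range k, (X i ω : ℝ) - 2 * k ≤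
      ρ ^ 2 * (2 * √(k * Real.log (Real.log k))) := by
  have := hX.isProbabilityMeasure
  have hρ0 : 0 < ρ := by linarith
  obtain ⟨l₀, hl₀, hmgf⟩ := exists_one_div_one_sub_sq_le hρ
  set L : ℝ → ℝ := fun y => Real.log (Real.log y) with hL
  set x : ℕ → ℝ := fun j => ρ ^ 2 * (2 * √(ρ ^ j * L (ρ ^ j))) with hx
  set p : ℕ → Ω → Prop := fun j ω => ∃ k, 1 ≤ k ∧ k ≤ ⌊ρ ^ (j + 1)⌋₊ ∧
    x j ≤ ∑ i ∈ Finset.range k, (X i ω : ℝ) - 2 * k with hp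
  have hpow : Tendsto (fun j : ℕ => ρ ^ j) atTop atTop := tendsto_pow_atTop_atTop_of_one_lt hρ
  have hLpos : ∀ᶠ y : ℝ in atTop, 0 < L y := by
    filter_upwards [Real.tendsto_log_atTop.eventually_gt_atTop 1] with y hy
    exact Real.log_pos hy
  have hLsmall : ∀ᶠ y : ℝ in atTop, √(L y / y) ≤ l₀ := by
    have h1 := Real.isLittleO_log_id_atTop.def (c := l₀ ^ 2) (by positivity)
    filter_upwards [h1, Real.tendsto_log_atTop.eventually_gt_atTop 1, eventually_gt_atTop 0]
      with y hy hlog hy0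
    rw [Real.norm_eq_abs, Real.norm_eq_abs, id, abs_of_pos hy0, abs_of_pos (by linarith)] at hy
    rw [Real.sqrt_le_left hl₀.le, div_le_iff₀ hy0]
    exact (Real.log_le_self (by linarith)).trans hy
  have hbound : ∀ᶠ j : ℕ in atTop,
      P.real {ω | p j ω} ≤ ((j : ℝ) * Real.log ρ) ^ (-ρ) := by
    filter_upwards [hpow.eventually hLpos, hpow.eventually hLsmall,
      hpow.eventually (Real.tendsto_log_atTop.eventually_gt_atTop 1)] with j hLj hlj hlog
    set r := ρ ^ j with hr
    have hr0 : 0 < r := by positivity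
    -- Near-optimal choice for the Gaussian exponent: `l · x j = 2ρ²L` while the moment term costs
    -- at most `ρr · ρl² = ρ²L`. The remaining `-ρ²L ≤ -ρL` yields the summable `(j log ρ)^{-ρ}`.
    set l := √(L r / r) with hl
    have hl0 : 0 ≤ l := Real.sqrt_nonneg _
    obtain ⟨h2, hm⟩ := hmgf l hl0 hlj
    refine (hX.real_exists_le_sum_le hl0 h2 _).trans ?_
    have hN : (⌊ρ ^ (j + 1)⌋₊ : ℝ) ≤ ρ * r := by
      refine (Nat.floor_le (by positivity)).trans (le_of_eq ?_)
      rw [hr, pow_succ, mul_comm]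
    have hlr : l ^ 2 * r = L r := by
      rw [hl, Real.sq_sqrt (by positivity)]; field_simp
    have hlx : l * x j = 2 * ρ ^ 2 * L r := by
      rw [hx]
      simp only
      rw [← hr, show √(r * L r) = l * r by
        rw [show r * L r = (l * r) ^ 2 by rw [← hlr]; ring, Real.sqrt_sq (by positivity)], ← hlr]
      ring
    have hpos : 0 ≤ 1 / (1 - (Real.exp l - 1) ^ 2) := by
      have h0 : 0 ≤ Real.exp l - 1 := by linarith [Real.add_one_le_exp l]
      refine div_nonneg zero_le_one ?_
      nlinarith
    calc Real.exp (-(l * x j)) * (1 / (1 - (Real.exp l - 1) ^ 2)) ^ ⌊ρ ^ (j + 1)⌋₊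
        ≤ Real.exp (-(l * x j)) * Real.exp (ρ * l ^ 2) ^ ⌊ρ ^ (j + 1)⌋₊ := by gcongr
      _ = Real.exp (-(l * x j) + ⌊ρ ^ (j + 1)⌋₊ * (ρ * l ^ 2)) := by
          rw [← Real.exp_nat_mul, ← Real.exp_add]
      _ ≤ Real.exp (Real.log (Real.log r) * -ρ) := by
          rw [Real.exp_le_exp, hlx]
          have h5 : (⌊ρ ^ (j + 1)⌋₊ : ℝ) * (ρ * l ^ 2) ≤ ρ * r * (ρ * l ^ 2) := by gcongr
          have h6 : ρ * r * (ρ * l ^ 2) = ρ ^ 2 * L r := by rw [← hlr]; ring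
          have h7 : ρ * L r ≤ ρ ^ 2 * L r := by gcongr; nlinarith
          change -(2 * ρ ^ 2 * L r) + _ ≤ L r * -ρ
          linarith
      _ = ((j : ℝ) * Real.log ρ) ^ (-ρ) := by
          rw [← Real.rpow_def_of_pos (by linarith), hr, Real.log_pow]
  have hsum : Summable fun j => P.real {ω | p j ω} := by
    have h1 : Summable fun j : ℕ => ((j : ℝ) * Real.log ρ) ^ (-ρ) := by
      have h2 := (Real.summable_nat_rpow.2 (neg_lt_neg hρ)).mul_right (Real.log ρ ^ (-ρ))
      refine h2.congr fun j => ?_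
      rw [Real.mul_rpow (by positivity) (Real.log_nonneg hρ.le)]
    refine summable_of_isBigO_nat h1 (Asymptotics.IsBigO.of_bound 1 ?_)
    filter_upwards [hbound] with j hj
    rw [Real.norm_eq_abs, abs_of_nonneg measureReal_nonneg, one_mul]
    exact hj.trans (le_abs_self _)
  filter_upwards [ae_eventually_not_of_summable hsum] with ω hω
  obtain ⟨J, hJ⟩ := eventually_atTop.1
    (hω.and (hpow.eventually (Real.tendsto_log_atTop.eventually_gt_atTop 1)))
  filter_upwards [tendsto_natCast_atTop_atTop.eventually_ge_atTop (ρ ^ J),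
    eventually_ge_atTop 1] with k hk hk1
  obtain ⟨j, hj1, hj2⟩ := exists_nat_pow_near (show (1 : ℝ) ≤ k by exact_mod_cast hk1) hρ
  have hJj : J ≤ j := by
    by_contra h
    have : ρ ^ (j + 1) ≤ ρ ^ J := pow_le_pow_right₀ hρ.le (by omega)
    linarith
  obtain ⟨h1, h2⟩ := hJ j hJj
  have h3 : ¬ x j ≤ ∑ i ∈ Finset.range k, (X i ω : ℝ) - 2 * k := fun h =>
    h1 ⟨k, hk1, Nat.le_floor hj2.le, h⟩
  refine (not_le.1 h3).le.trans ?_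
  simp only [hx, hL]
  have h4 : 0 < ρ ^ j := by positivity
  have h5 : Real.log (ρ ^ j) ≤ Real.log k := Real.log_le_log h4 hj1
  have h6 : Real.log (Real.log (ρ ^ j)) ≤ Real.log (Real.log k) :=
    Real.log_le_log (by linarith) h5
  have h7 : 0 ≤ Real.log (Real.log (ρ ^ j)) := Real.log_nonneg h2.le
  gcongr

end IsGeometricSeq

/-! ### Lower half of the iterated logarithm -/

/-- Sums of independent variables over disjoint blocks of indices are independent. -/
theorem iIndepFun_sum_of_pairwise_disjoint {Ω : Type*} [MeasurableSpace Ω] {P : Measure Ω}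
    {X : ℕ → Ω → ℕ} (hX : ∀ i, Measurable (X i)) (hind : iIndepFun X P) {T : ℕ → Finset ℕ}
    (hT : ∀ i j, i ≠ j → Disjoint (T i) (T j)) :
    iIndepFun (fun j ω => ∑ i ∈ T j, X i ω) P := by
  have := hind.isProbabilityMeasure
  rw [iIndepFun_iff_measure_inter_preimage_eq_mul]
  intro S sets hsets
  induction S using Finset.induction_on with
  | empty => simp
  | insert a S ha ih =>
    have hdisj : Disjoint (T a) (S.biUnion T) := by
      rw [Finset.disjoint_biUnion_right]
      intro j hj
      exact hT a j fun h => ha (h ▸ hj)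
    have h := hind.indepFun_finset (T a) (S.biUnion T) hdisj hX
    have h1 : MeasurableSet {y : T a → ℕ | ∑ i, y i ∈ sets a} :=
      (Finset.measurable_fun_sum Finset.univ fun i _ => measurable_pi_apply i)
        (hsets a (Finset.mem_insert_self a S))
    have h2 : MeasurableSet
        {y : S.biUnion T → ℕ | ∀ j (hj : j ∈ S),
          ∑ i : T j, y ⟨i, Finset.mem_biUnion.2 ⟨j, hj, i.2⟩⟩ ∈ sets j} := by
      simp only [Set.ofPred_forall]
      refine MeasurableSet.iInter fun j => MeasurableSet.iInter fun hj => ?_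
      have hm : Measurable fun y : S.biUnion T → ℕ =>
          ∑ i : T j, y ⟨i, Finset.mem_biUnion.2 ⟨j, hj, i.2⟩⟩ :=
        Finset.measurable_fun_sum Finset.univ fun i _ => measurable_pi_apply
          (⟨i, Finset.mem_biUnion.2 ⟨j, hj, i.2⟩⟩ : S.biUnion T)
      exact hm (hsets j (Finset.mem_insert_of_mem hj))
    have h3 := h.measure_inter_preimage_eq_mul _ _ h1 h2
    have e1 : (fun ω (i : T a) => X i ω) ⁻¹' {y : T a → ℕ | ∑ i, y i ∈ sets a} =
        (fun ω => ∑ i ∈ T a, X i ω) ⁻¹' sets a := by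
      ext ω
      simp only [Set.mem_preimage, Set.mem_ofPred_eq]
      rw [Finset.sum_coe_sort (T a) fun i => X i ω]
    have e2 : (fun ω (i : S.biUnion T) => X i ω) ⁻¹' {y : S.biUnion T → ℕ | ∀ j (hj : j ∈ S),
          ∑ i : T j, y ⟨i, Finset.mem_biUnion.2 ⟨j, hj, i.2⟩⟩ ∈ sets j} =
        ⋂ j ∈ S, (fun ω => ∑ i ∈ T j, X i ω) ⁻¹' sets j := by
      ext ω
      simp only [Set.mem_preimage, Set.mem_ofPred_eq, Set.mem_iInter]
      refine forall₂_congr fun j hj => ?_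
      rw [Finset.sum_coe_sort (T j) fun i => X i ω]
    rw [e1, e2, ih fun i hi => hsets i (Finset.mem_insert_of_mem hi)] at h3
    rw [Finset.set_biInter_insert, Finset.prod_insert ha, h3]

namespace IsGeometricSeq

/-- Gaussian lower bound for the upper tail of sums of geometric variables. -/
theorem exists_tail_lower_bound : ∃ C : ℝ, 0 ≤ C ∧
    ∀ {Ω : Type*} [MeasurableSpace Ω] {P : Measure Ω} {X : ℕ → Ω → ℕ}, IsGeometricSeq X P →
      ∀ s : Finset ℕ, 4 ≤ s.card → ∀ y : ℝ, 0 ≤ y →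
        1 / 2 * (1 / (2 * √Real.pi) * Real.exp (-(y + √s.card) ^ 2 / (4 * s.card)) -
          C / √s.card) ≤
          P.real {ω | 2 * (s.card : ℝ) + y ≤ ((∑ i ∈ s, X i ω : ℕ) : ℝ)} := by
  obtain ⟨C, hC, hllt⟩ := exists_local_limit_bound
  refine ⟨C, hC, ?_⟩
  intro Ω _ P X hX s hs y hy
  have := hX.isProbabilityMeasure
  set k := s.card with hk
  have hkR : (4 : ℝ) ≤ k := by exact_mod_cast hs
  have hk0 : (0 : ℝ) < k := by linarith
  have hsq2 : 2 ≤ √(k : ℝ) := by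
    rw [show (2 : ℝ) = √4 by rw [show (4 : ℝ) = 2 ^ 2 by norm_num, Real.sqrt_sq (by norm_num)]]
    exact Real.sqrt_le_sqrt hkR
  have hsq0 : 0 < √(k : ℝ) := by linarith
  set g := 1 / (2 * √Real.pi) * Real.exp (-(y + √k) ^ 2 / (4 * k)) - C / √k with hg
  rcases le_or_gt g 0 with hg0 | hg0
  · exact le_trans (by linarith) measureReal_nonneg
  -- The integers `a, …, a + M - 1` all exceed `2k` by at least `y` and at most `y + √k`. Their
  -- number satisfies `M ≥ √k/2` because `√k ≥ 2`, whence the factor `1/2`.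
  set a := ⌈2 * (k : ℝ) + y⌉ with ha
  set M := ⌊√(k : ℝ)⌋₊ with hM
  have ha1 : 2 * (k : ℝ) + y ≤ a := Int.le_ceil _
  have ha2 : (a : ℝ) < 2 * k + y + 1 := Int.ceil_lt_add_one _
  have hM1 : (M : ℝ) ≤ √k := Nat.floor_le hsq0.le
  have hM2 : √(k : ℝ) < M + 1 := Nat.lt_floor_add_one _
  have hterm : ∀ i ∈ Finset.range M,
      g / √k ≤ P.real {ω | ((∑ i ∈ s, X i ω : ℕ) : ℤ) = a + i} := by
    intro i hi
    have hi : i + 1 ≤ M := Finset.mem_range.1 hi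
    have hiR : (i : ℝ) + 1 ≤ M := by exact_mod_cast hi
    have h1 := (abs_le.1 (hllt hX s (Finset.card_pos.1 (by omega)) (a + i))).1
    rw [← hk] at h1
    have h2 : (((a + i : ℤ) : ℝ) - 2 * k) ^ 2 ≤ (y + √k) ^ 2 := by
      push_cast
      have h3 : (0 : ℝ) ≤ a + i - 2 * k := by
        have : (0 : ℝ) ≤ i := i.cast_nonneg
        linarith
      have h4 : (a : ℝ) + i - 2 * k ≤ y + √k := by linarith
      gcongr
    have h3 : Real.exp (-(y + √k) ^ 2 / (4 * k)) ≤
        Real.exp (-(((a + i : ℤ) : ℝ) - 2 * k) ^ 2 / (4 * k)) := by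
      gcongr
    have h4 : 1 / (2 * √Real.pi) * Real.exp (-(y + √k) ^ 2 / (4 * k)) ≤
        1 / (2 * √Real.pi) * Real.exp (-(((a + i : ℤ) : ℝ) - 2 * k) ^ 2 / (4 * k)) := by
      gcongr
    rw [div_le_iff₀ hsq0, mul_comm]
    linarith
  have hmeas : ∀ i : ℕ, MeasurableSet {ω | ((∑ i ∈ s, X i ω : ℕ) : ℤ) = a + i} := fun i =>
    (measurable_from_top (f := fun m : ℕ => (m : ℤ))).comp (hX.measurable_sum s)
      (measurableSet_singleton (a + i : ℤ))
  have hsub : (⋃ i ∈ Finset.range M, {ω | ((∑ i ∈ s, X i ω : ℕ) : ℤ) = a + i}) ⊆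
      {ω | 2 * (k : ℝ) + y ≤ ((∑ i ∈ s, X i ω : ℕ) : ℝ)} := by
    intro ω hω
    simp only [Set.mem_iUnion, exists_prop] at hω
    obtain ⟨i, _, h⟩ := hω
    have h2 : (((∑ i ∈ s, X i ω : ℕ) : ℤ) : ℝ) = ((a + i : ℤ) : ℝ) := congrArg Int.cast h
    change 2 * (k : ℝ) + y ≤ ((∑ i ∈ s, X i ω : ℕ) : ℝ)
    rw [Int.cast_natCast, Int.cast_add, Int.cast_natCast] at h2
    rw [h2]
    have : (0 : ℝ) ≤ i := i.cast_nonneg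
    linarith
  calc 1 / 2 * g ≤ M * (g / √k) := by
        rw [mul_div_assoc', le_div_iff₀ hsq0]
        nlinarith
    _ = ∑ _i ∈ Finset.range M, g / √k := by simp
    _ ≤ ∑ i ∈ Finset.range M, P.real {ω | ((∑ i ∈ s, X i ω : ℕ) : ℤ) = a + i} :=
        Finset.sum_le_sum hterm
    _ = P.real (⋃ i ∈ Finset.range M, {ω | ((∑ i ∈ s, X i ω : ℕ) : ℤ) = a + i}) := by
        rw [measureReal_biUnion_finset]
        · intro i _ j _ hij
          rw [Function.onFun, Set.disjoint_left]
          intro ω h1 h2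
          have h3 : (a + i : ℤ) = a + j := Eq.trans (Eq.symm h1) h2
          omega
        · exact fun i _ => hmeas i
    _ ≤ _ := measureReal_mono hsub

variable {Ω : Type*} [MeasurableSpace Ω] {P : Measure Ω} {X : ℕ → Ω → ℕ}

/-- Chebyshev gives the probability bound `2(j!)² / (η (j+1)!)² = 2/(η²(j+1)²)`, which is summable;
this is what the factorial block lengths buy. -/
theorem ae_eventually_abs_sum_lt (hX : IsGeometricSeq X P) {η : ℝ} (hη : 0 < η) :
    ∀ᵐ ω ∂P, ∀ᶠ j : ℕ in atTop,
      |∑ i ∈ Finset.range (j.factorial ^ 2), (X i ω : ℝ) - 2 * (j.factorial : ℝ) ^ 2| <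
        η * (j + 1).factorial := by
  have := hX.isProbabilityMeasure
  have hs : Summable fun j : ℕ => P.real {ω | η * (j + 1).factorial ≤
      |∑ i ∈ Finset.range (j.factorial ^ 2), (X i ω : ℝ) - 2 * (j.factorial : ℝ) ^ 2|} := by
    have h1 : Summable fun j : ℕ => 2 / η ^ 2 * (1 / ((j + 1 : ℕ) : ℝ) ^ 2) :=
      ((summable_nat_add_iff 1).2 (Real.summable_one_div_nat_pow.2 one_lt_two)).mul_left _
    refine Summable.of_nonneg_of_le (fun _ => measureReal_nonneg) (fun j => ?_) h1
    have hc : 0 < η * ((j + 1).factorial : ℝ) := by positivity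
    have hL : MemLp (fun ω => ∑ i ∈ Finset.range (j.factorial ^ 2), (X i ω : ℝ)) 2 P :=
      memLp_finsetSum _ fun i _ => hX.memLp_two i
    have h := ENNReal.toReal_mono ENNReal.ofReal_ne_top (meas_ge_le_variance_div_sq hL hc)
    rw [hX.variance_sum_eq, hX.integral_sum_eq, Finset.card_range,
      ENNReal.toReal_ofReal (by positivity)] at h
    push_cast at h
    refine h.trans (le_of_eq ?_)
    rw [Nat.factorial_succ]
    have : (j.factorial : ℝ) ≠ 0 := by positivity
    push_cast
    field_simp
  filter_upwards [ae_eventually_not_of_summable hs] with ω hω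
  filter_upwards [hω] with j hj
  exact not_le.1 hj

theorem tendsto_factorial_sq : Tendsto (fun j : ℕ => (j + 1).factorial ^ 2) atTop atTop := by
  refine tendsto_atTop_mono (fun j => ?_) tendsto_id
  have h1 := Nat.self_le_factorial (j + 1)
  have h2 : (j + 1).factorial ≤ (j + 1).factorial ^ 2 := Nat.le_self_pow two_ne_zero _
  simp only [id]
  omega

/-- From `n! ≤ nⁿ`, the iterated logarithm is at most `log (j+1) + log log (j+1) + log 2`, and the
factor `σ² < 1` absorbs the last two terms. -/
theorem log_log_factorial_sq_eventually_le {σ : ℝ} (hσ0 : 0 < σ) (hσ : σ < 1) :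
    ∀ᶠ j : ℕ in atTop, σ ^ 2 * Real.log (Real.log (((j + 1).factorial : ℝ) ^ 2)) ≤
      Real.log ((j : ℝ) + 1) := by
  have hσ2 : σ ^ 2 < 1 := by nlinarith
  set c := (1 / σ ^ 2 - 1) / 2 with hc
  have hc0 : 0 < c := by
    have : 1 < 1 / σ ^ 2 := by rw [lt_div_iff₀ (by positivity)]; linarith
    rw [hc]; linarith
  have hlog : Tendsto (fun j : ℕ => Real.log ((j : ℝ) + 1)) atTop atTop := by
    have h := Real.tendsto_log_atTop.comp
      (tendsto_natCast_atTop_atTop (R := ℝ) |>.comp (tendsto_add_atTop_nat 1))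
    refine h.congr fun j => ?_
    simp
  have h1 : ∀ᶠ m : ℝ in atTop, Real.log 2 + Real.log m ≤ (1 / σ ^ 2 - 1) * m := by
    filter_upwards [Real.isLittleO_log_id_atTop.def hc0, eventually_ge_atTop (Real.log 2 / c),
      eventually_ge_atTop 1] with m hm hm2 hm1
    rw [Real.norm_eq_abs, Real.norm_eq_abs, id, abs_of_nonneg (Real.log_nonneg hm1),
      abs_of_nonneg (by linarith)] at hm
    rw [div_le_iff₀ hc0] at hm2
    have : (1 / σ ^ 2 - 1) * m = c * m + m * c := by rw [hc]; ring
    linarith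
  filter_upwards [hlog.eventually h1, hlog.eventually_ge_atTop 1, eventually_ge_atTop 1]
    with j hj hj1 hj2
  set m := Real.log ((j : ℝ) + 1) with hm
  have hj0 : (0 : ℝ) < (j : ℝ) + 1 := by positivity
  have hfac : Real.log (((j + 1).factorial : ℝ) ^ 2) ≤ 2 * (((j : ℝ) + 1) * m) := by
    rw [Real.log_pow]
    have h2 : ((j + 1).factorial : ℝ) ≤ ((j : ℝ) + 1) ^ (j + 1) := by
      exact_mod_cast Nat.factorial_le_pow (j + 1)
    have h3 := Real.log_le_log (by positivity) h2
    rw [Real.log_pow] at h3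
    push_cast at h3 ⊢
    linarith
  have hpos : 0 < Real.log (((j + 1).factorial : ℝ) ^ 2) := by
    refine Real.log_pos ?_
    have : 2 ≤ (j + 1).factorial := (by omega : 2 ≤ j + 1).trans (Nat.self_le_factorial _)
    have : (2 : ℝ) ≤ ((j + 1).factorial : ℝ) := by exact_mod_cast this
    nlinarith
  have h4 := Real.log_le_log hpos hfac
  rw [Real.log_mul two_ne_zero (by positivity), Real.log_mul hj0.ne' (by positivity), ← hm] at h4
  have h5 : Real.log (Real.log (((j + 1).factorial : ℝ) ^ 2)) ≤ 1 / σ ^ 2 * m := by linarith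
  calc _ ≤ σ ^ 2 * (1 / σ ^ 2 * m) := by gcongr
    _ = m := by field_simp

theorem not_summable_of_eventually_ge {f : ℕ → ℝ} {c : ℝ} (hc : 0 < c)
    (h : ∀ᶠ j : ℕ in atTop, c / ((j : ℝ) + 1) ≤ f j) : ¬ Summable f := by
  intro hf
  have h1 : Summable fun j : ℕ => 1 / ((j + 1 : ℕ) : ℝ) := by
    refine summable_of_isBigO_nat hf (Asymptotics.IsBigO.of_bound (1 / c) ?_)
    filter_upwards [h] with j hj
    have h2 : (0 : ℝ) < 1 / ((j : ℝ) + 1) := by positivity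
    push_cast
    rw [Real.norm_eq_abs, abs_of_pos h2]
    calc 1 / ((j : ℝ) + 1) = 1 / c * (c / ((j : ℝ) + 1)) := by field_simp
      _ ≤ 1 / c * ‖f j‖ := by gcongr; exact hj.trans (le_abs_self _)
  exact Real.not_summable_one_div_natCast
    ((summable_nat_add_iff (f := fun n : ℕ => 1 / (n : ℝ)) 1).1 h1)

/-- Lower half of the law of the iterated logarithm. -/
theorem ae_frequently_le_sum (hX : IsGeometricSeq X P) {ρ : ℝ} (hρ0 : 0 < ρ) (hρ : ρ < 1) :
    ∀ᵐ ω ∂P, ∃ᶠ k : ℕ in atTop, ρ * (2 * √(k * Real.log (Real.log k))) ≤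
      ∑ i ∈ Finset.range k, (X i ω : ℝ) - 2 * k := by
  have := hX.isProbabilityMeasure
  obtain ⟨C, hC, htail⟩ := exists_tail_lower_bound
  -- The slack `ρ' - ρ` pays for the past of a block. The factor `κ > 1` compares `(j+1)!` with the
  -- square root of the block length, and `σ - ρ'κ > 0` absorbs the extra `√K` in the tail bound.
  obtain ⟨ρ', hρ'1, hρ'2⟩ := exists_between hρ
  obtain ⟨σ, hσ1, hσ2⟩ := exists_between hρ'2
  have hρ'0 : 0 < ρ' := hρ0.trans hρ'1
  have hσ0 : 0 < σ := hρ'0.trans hσ1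
  obtain ⟨κ, hκ1, hκ2⟩ := exists_between ((one_lt_div hρ'0).2 hσ1)
  have hκ0 : 0 < κ := by linarith
  have hκσ : ρ' * κ < σ := by rw [lt_div_iff₀ hρ'0] at hκ2; linarith
  set T : ℕ → Finset ℕ := fun j => Finset.Ico (j.factorial ^ 2) ((j + 1).factorial ^ 2) with hT
  set L : ℕ → ℝ := fun j => Real.log (Real.log (((j + 1).factorial : ℝ) ^ 2)) with hL
  set y : ℕ → ℝ := fun j => ρ' * (2 * ((j + 1).factorial * √(L j))) with hy
  have hmono : Monotone fun j : ℕ => j.factorial ^ 2 := fun i j hij =>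
    Nat.pow_le_pow_left (Nat.factorial_le hij) 2
  have hdisj : ∀ i j, i ≠ j → Disjoint (T i) (T j) := by
    intro i j hij
    rw [Finset.disjoint_left]
    intro a ha hb
    rw [Finset.mem_Ico] at ha hb
    rcases lt_or_gt_of_ne hij with h | h
    · have := hmono (Nat.succ_le_of_lt h)
      simp only [Nat.succ_eq_add_one] at this
      omega
    · have := hmono (Nat.succ_le_of_lt h)
      simp only [Nat.succ_eq_add_one] at this
      omega
  have hLtop : Tendsto L atTop atTop := by
    have h := Real.tendsto_log_atTop.comp (Real.tendsto_log_atTop.comp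
      ((tendsto_natCast_atTop_atTop (R := ℝ)).comp tendsto_factorial_sq))
    refine h.congr fun j => ?_
    simp [hL]
  have hcard : ∀ j, ((T j).card : ℝ) =
      ((j + 1).factorial : ℝ) ^ 2 * (1 - 1 / ((j : ℝ) + 1) ^ 2) := by
    intro j
    rw [Nat.card_Ico, Nat.cast_sub (hmono (Nat.le_succ j))]
    push_cast [Nat.factorial_succ]
    have : (j : ℝ) + 1 ≠ 0 := by positivity
    field_simp
  have hfrac : ∀ᶠ j : ℕ in atTop, (1 / κ) ^ 2 ≤ 1 - 1 / ((j : ℝ) + 1) ^ 2 := by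
    have h1 : Tendsto (fun j : ℕ => 1 - (1 / ((j : ℝ) + 1)) ^ 2) atTop (𝓝 1) := by
      simpa using ((tendsto_one_div_add_atTop_nhds_zero_nat (𝕜 := ℝ)).pow 2).const_sub 1
    have h2 : (1 / κ) ^ 2 < 1 := by
      have h3 : 1 / κ < 1 := by rw [div_lt_one hκ0]; exact hκ1
      have h4 : 0 < 1 / κ := by positivity
      nlinarith
    filter_upwards [h1.eventually_const_lt h2] with j hj
    rw [one_div_pow ((j : ℝ) + 1)] at hj
    exact hj.le
  have hsqrt : ∀ᶠ j : ℕ in atTop, ((j + 1).factorial : ℝ) ≤ κ * √((T j).card : ℝ) := by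
    filter_upwards [hfrac] with j hj
    have h1 : (((j + 1).factorial : ℝ) / κ) ≤ √((T j).card : ℝ) := by
      refine Real.le_sqrt_of_sq_le ?_
      rw [hcard, div_eq_mul_one_div, mul_pow]
      gcongr
    rw [div_le_iff₀ hκ0] at h1
    linarith
  -- A quarter of `1/(2√π)`: the main term is at least `4c/(j+1)`, the local limit error at most
  -- `2c/(j+1)`, and half of the difference is `c/(j+1)`.
  set c := 1 / (8 * √Real.pi) with hc
  have hc0 : 0 < c := by positivity
  have hprob : ∀ᶠ j : ℕ in atTop, c / ((j : ℝ) + 1) ≤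
      P.real {ω | ∑ i ∈ T j, X i ω ∈ {n : ℕ | 2 * ((T j).card : ℝ) + y j ≤ (n : ℝ)}} := by
    filter_upwards [hsqrt, log_log_factorial_sq_eventually_le hσ0 hσ2,
      hLtop.eventually_ge_atTop ((1 / (2 * (σ - ρ' * κ))) ^ 2),
      eventually_ge_atTop (2 + ⌈2 * κ⌉₊),
      (tendsto_natCast_atTop_atTop (R := ℝ)).eventually_ge_atTop (C * κ / (2 * c))]
      with j hsq hlog hLj hj hjC
    have hj2R : (2 : ℝ) + 2 * κ ≤ j := by
      have h1 : ((2 + ⌈2 * κ⌉₊ : ℕ) : ℝ) ≤ j := by exact_mod_cast hj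
      push_cast at h1
      linarith [Nat.le_ceil (2 * κ)]
    have hj0 : (0 : ℝ) < j := by linarith
    set K : ℝ := ((T j).card : ℝ) with hK
    set F : ℝ := ((j + 1).factorial : ℝ) with hF
    have hFj : ((j : ℝ) + 1) * j ≤ F := by
      rw [hF, Nat.factorial_succ]
      push_cast
      have : (j : ℝ) ≤ j.factorial := by exact_mod_cast Nat.self_le_factorial j
      gcongr
    have hsK : (((j : ℝ) + 1) * j) / κ ≤ √K := by
      rw [div_le_iff₀ hκ0]; linarith
    have hsK2 : 2 ≤ √K := by
      refine le_trans ?_ hsK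
      rw [le_div_iff₀ hκ0]
      nlinarith
    have hsK0 : 0 < √K := by linarith
    have hKsq : √K ^ 2 = K := Real.sq_sqrt (Nat.cast_nonneg _)
    have hK4 : 4 ≤ (T j).card := by
      have : (4 : ℝ) ≤ ((T j).card : ℝ) := by nlinarith
      exact_mod_cast this
    have hsL : 1 ≤ 2 * (σ - ρ' * κ) * √(L j) := by
      have h1 : 0 < 2 * (σ - ρ' * κ) := by linarith
      have h2 := Real.le_sqrt_of_sq_le hLj
      rw [div_le_iff₀ h1] at h2
      linarith
    have hL0 : 0 ≤ L j := le_trans (by positivity) hLj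
    have hyn : 0 ≤ y j := by positivity
    have hyK : y j + √K ≤ 2 * σ * √(L j) * √K := by
      have h1 : y j ≤ ρ' * (2 * ((κ * √K) * √(L j))) := by
        simp only [hy]
        gcongr
      have h2 : 1 * √K ≤ 2 * (σ - ρ' * κ) * √(L j) * √K := by gcongr
      nlinarith
    have hexp : 1 / ((j : ℝ) + 1) ≤ Real.exp (-(y j + √K) ^ 2 / (4 * K)) := by
      rw [one_div, ← Real.exp_log (show (0 : ℝ) < (j : ℝ) + 1 by positivity), ← Real.exp_neg,
        Real.exp_le_exp, neg_div]
      refine neg_le_neg (le_trans ?_ hlog)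
      rw [div_le_iff₀ (by rw [← hKsq]; positivity)]
      calc (y j + √K) ^ 2 ≤ (2 * σ * √(L j) * √K) ^ 2 := by gcongr
        _ = σ ^ 2 * √(L j) ^ 2 * (4 * √K ^ 2) := by ring
        _ = σ ^ 2 * L j * (4 * K) := by rw [hKsq, Real.sq_sqrt hL0]
    have hCK : C / √K ≤ 2 * c / ((j : ℝ) + 1) := by
      rw [div_le_div_iff₀ hsK0 (by positivity)]
      rw [div_le_iff₀ (by positivity)] at hjC
      have h1 : (((j : ℝ) + 1) * j) ≤ √K * κ := by rwa [div_le_iff₀ hκ0] at hsK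
      have h2 : C * κ * ((j : ℝ) + 1) ≤ 2 * c * (√K * κ) := by
        calc C * κ * ((j : ℝ) + 1) ≤ j * (2 * c) * ((j : ℝ) + 1) := by gcongr
          _ = 2 * c * (((j : ℝ) + 1) * j) := by ring
          _ ≤ 2 * c * (√K * κ) := by gcongr
      exact le_of_mul_le_mul_right (by linarith) hκ0
    refine le_trans ?_ (htail hX (T j) hK4 (y j) hyn)
    have h3 : 1 / (2 * √Real.pi) * (1 / ((j : ℝ) + 1)) ≤
        1 / (2 * √Real.pi) * Real.exp (-(y j + √K) ^ 2 / (4 * K)) := by gcongr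
    have h4 : 1 / (2 * √Real.pi) * (1 / ((j : ℝ) + 1)) = 4 * (c / ((j : ℝ) + 1)) := by
      rw [hc]
      have : √Real.pi ≠ 0 := by positivity
      field_simp
      norm_num
    have h5 : 2 * c / ((j : ℝ) + 1) = 2 * (c / ((j : ℝ) + 1)) := by ring
    linarith
  have hfreq := ae_frequently_mem_of_not_summable
    (S := fun j => {n : ℕ | 2 * ((T j).card : ℝ) + y j ≤ (n : ℝ)})
    (fun j => hX.measurable_sum (T j))
    (iIndepFun_sum_of_pairwise_disjoint hX.measurable hX.indep hdisj)
    (fun _ => MeasurableSet.of_discrete) (not_summable_of_eventually_ge hc0 hprob)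
  filter_upwards [hfreq,
    hX.ae_eventually_abs_sum_lt (show 0 < 2 * (ρ' - ρ) by linarith)] with ω h1 h2
  -- The limsup is realized along `k = ((j+1)!)²`: a large block sum survives adding the past, whose
  -- deviation is below `2(ρ' - ρ)(j+1)!`, and `√(L j) ≥ 1` makes this affordable.
  refine tendsto_factorial_sq.frequently ?_
  refine (h1.and_eventually (h2.and (hLtop.eventually_ge_atTop 1))).mono ?_
  rintro j ⟨hD, hS, hL1⟩
  have hD' : 2 * ((T j).card : ℝ) + y j ≤ ((∑ i ∈ T j, X i ω : ℕ) : ℝ) := hD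
  rw [Nat.card_Ico, Nat.cast_sub (hmono (Nat.le_succ j))] at hD'
  have hsplit : ∑ i ∈ Finset.range ((j + 1).factorial ^ 2), (X i ω : ℝ) =
      ∑ i ∈ Finset.range (j.factorial ^ 2), (X i ω : ℝ) + ∑ i ∈ T j, (X i ω : ℝ) :=
    (Finset.sum_range_add_sum_Ico _ (hmono (Nat.le_succ j))).symm
  push_cast at hD' ⊢
  rw [hsplit]
  have h3 := (abs_lt.1 hS).1
  have h4 : √(((j + 1).factorial : ℝ) ^ 2 * L j) = (j + 1).factorial * √(L j) := by
    rw [Real.sqrt_mul (by positivity), Real.sqrt_sq (by positivity)]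
  have h5 : (1 : ℝ) ≤ √(L j) := by
    rw [Real.one_le_sqrt]; exact hL1
  change ρ * (2 * √(((j + 1).factorial : ℝ) ^ 2 * L j)) ≤ _
  rw [h4]
  have h6 : 2 * (ρ' - ρ) * ((j + 1).factorial : ℝ) ≤
      2 * (ρ' - ρ) * ((j + 1).factorial : ℝ) * √(L j) := by
    refine le_mul_of_one_le_right ?_ h5
    have : 0 ≤ ρ' - ρ := by linarith
    positivity
  have h7 : y j = ρ' * (2 * ((j + 1).factorial * √(L j))) := rfl
  rw [h7] at hD'
  nlinarith

end IsGeometricSeq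

/-! ### Series for the characteristic function, central limit theorem, and assembly -/

theorem hasSum_subtype_one_le {E : Type*} [AddCommMonoid E] [TopologicalSpace E] {f : ℕ → E}
    {a : E} (hf : HasSum f a) (h0 : f 0 = 0) : HasSum (fun m : {m : ℕ // 1 ≤ m} => f m) a := by
  refine (hasSum_subtype_iff_of_support_subset (s := {m : ℕ | 1 ≤ m}) fun m hm => ?_).2 hf
  refine Nat.one_le_iff_ne_zero.2 fun h => hm ?_
  rw [h, h0]

namespace IsGeometricSeq

variable {Ω : Type*} [MeasurableSpace Ω] {P : Measure Ω} {X : ℕ → Ω → ℕ}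

theorem hasSum_integral_exp_sum (hX : IsGeometricSeq X P) {s : Finset ℕ} (hs : s.Nonempty)
    (t : ℝ) : HasSum
      (fun ν : {ν : ℕ // 1 ≤ ν} =>
        Complex.exp (2 * Complex.I * Real.pi * (ν.val : ℂ) * t) / 2 ^ ν.val *
          ((ν.val - 1).choose (s.card - 1) : ℂ))
      (∫ ω, Complex.exp (2 * Complex.I * Real.pi * ((∑ i ∈ s, X i ω : ℕ) : ℂ) * t) ∂P) := by
  have := hX.isProbabilityMeasure
  set f : ℕ → ℂ := fun n => Complex.exp (2 * Complex.I * Real.pi * (n : ℂ) * t) with hf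
  have hnorm : ∀ n, ‖f n‖ = 1 := by
    intro n
    have := Complex.norm_exp_ofReal_mul_I (2 * Real.pi * n * t)
    rw [← this, hf]
    push_cast
    congr 2
    ring
  have hint : Integrable (fun ω => f (∑ i ∈ s, X i ω)) P :=
    Integrable.of_bound ((measurable_from_top (f := f)).comp
      (hX.measurable_sum s)).aestronglyMeasurable 1 (Eventually.of_forall fun ω => (hnorm _).le)
  have h := hasSum_subtype_one_le (hasSum_integral_comp_nat (hX.measurable_sum s) f hint) (by
    rw [hX.real_sum_eq hs, if_pos rfl, zero_smul])
  refine h.congr_fun fun ν => ?_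
  rw [hX.real_sum_eq hs, if_neg (by have := ν.2; omega), Complex.real_smul]
  push_cast
  simp only [hf]
  ring

theorem tendstoInDistribution_sum (hX : IsGeometricSeq X P) [IsProbabilityMeasure P] :
    TendstoInDistribution
      (fun (k : ℕ) (ω : Ω) => (∑ i ∈ Finset.range k, (X i ω : ℝ) - 2 * k) / √(2 * k)) atTop
      (id : ℝ → ℝ) (fun _ => P) (gaussianReal 0 1) := by
  have h1 := hX.integrable_natCast_and_integral 0
  have h2 := hX.integrable_sq_and_integral 0
  have hsq : √(2 : ℝ) ^ 2 = 2 := Real.sq_sqrt (by norm_num)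
  have hg : Measurable fun n : ℕ => ((n : ℝ) - 2) / √2 := by fun_prop
  have h := tendstoInDistribution_inv_sqrt_mul_sum (P := P) (P' := gaussianReal 0 1)
    (Y := (id : ℝ → ℝ)) (X := fun i ω => ((X i ω : ℝ) - 2) / √2) HasLaw.id
    (by rw [integral_div, integral_sub h1.1 (integrable_const _), h1.2]; simp)
    (by
      have he : ((fun ω => ((X 0 ω : ℝ) - 2) / √2) ^ 2) =
          fun ω => (((X 0 ω : ℝ) ^ 2 - 4 * (X 0 ω : ℝ)) + 4) / 2 := by
        funext ω
        rw [Pi.pow_apply, div_pow, hsq]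
        ring
      have h3 : Integrable (fun ω => (X 0 ω : ℝ) ^ 2 - 4 * (X 0 ω : ℝ)) P :=
        h2.1.sub (h1.1.const_mul 4)
      rw [he, integral_div, integral_add h3 (integrable_const _),
        integral_sub h2.1 (h1.1.const_mul 4), integral_const_mul, h1.2, h2.2]
      simp
      norm_num)
    (hX.indep.comp (fun _ n => ((n : ℝ) - 2) / √2) fun _ => hg)
    (fun i => (IdentDistrib.mk (hX.measurable i).aemeasurable (hX.measurable 0).aemeasurable
      (by rw [hX.law, hX.law])).comp hg)
  convert! h using 3 with k ω
  rw [← Finset.sum_div, Finset.sum_sub_distrib, Real.sqrt_mul (by norm_num)]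
  simp only [Finset.sum_const, Finset.card_range, nsmul_eq_mul]
  rw [mul_comm (2 : ℝ) k]
  field_simp

/-- The law of the iterated logarithm. -/
theorem ae_limsup_sum_eq_one (hX : IsGeometricSeq X P) :
    ∀ᵐ ω ∂P, limsup (fun k : ℕ => (((∑ i ∈ Finset.range k, (X i ω : ℝ) - 2 * k) /
      (2 * √(k * Real.log (Real.log k))) : ℝ) : EReal)) atTop = 1 := by
  have hpos : ∀ᶠ k : ℕ in atTop, 0 < 2 * √((k : ℝ) * Real.log (Real.log k)) := by
    filter_upwards [(Real.tendsto_log_atTop.comp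
      (tendsto_natCast_atTop_atTop (R := ℝ))).eventually_gt_atTop 1, eventually_gt_atTop 0]
      with k hk hk0
    have h1 := Real.log_pos hk
    have h2 : (0 : ℝ) < k := by exact_mod_cast hk0
    have h3 : 0 < (k : ℝ) * Real.log (Real.log k) := mul_pos h2 h1
    positivity
  refine ae_limsup_coe_eq_one (fun ρ hρ => ?_) fun ρ hρ0 hρ => ?_
  · have hρ0 : 0 ≤ ρ := by linarith
    -- The upper half loses a square, hence the level `√ρ`.
    filter_upwards [hX.ae_eventually_sum_le (ρ := √ρ)
      (by rw [Real.lt_sqrt (by norm_num)]; linarith)] with ω hω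
    filter_upwards [hω, hpos] with k hk hk0
    rw [Real.sq_sqrt hρ0] at hk
    rwa [div_le_iff₀ hk0]
  · filter_upwards [hX.ae_frequently_le_sum hρ0 hρ] with ω hω
    refine (hω.and_eventually hpos).mono fun k hk => ?_
    rw [le_div_iff₀ hk.2]
    exact hk.1

end IsGeometricSeq

theorem mainTheorem10 {Ω : Type*} [MeasurableSpace Ω] (P : Measure Ω) [IsProbabilityMeasure P]
    (ε : ℕ → Ω → ℕ) (hε : IsFairBernoulliSeq ε P) :
    -- almost surely, every infimum defining a gap is over a nonempty set
    (∀ᵐ ω ∂P, ∀ ℓ : ℕ, 1 ≤ ℓ →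
      {n : ℕ | 1 ≤ n ∧ ε (n + jumpTime ε (ℓ - 1) ω) ω = 1}.Nonempty) ∧
    -- (i) the gaps are i.i.d. and geometric
    (iIndepFun (fun ℓ : ℕ => gap ε (ℓ + 1)) P ∧
      (∀ ℓ : ℕ, 1 ≤ ℓ → IdentDistrib (gap ε ℓ) (gap ε 1) P P) ∧
      (∀ ℓ m : ℕ, 1 ≤ ℓ → 1 ≤ m → P.real {ω | gap ε ℓ ω = m} = 1 / (2 : ℝ) ^ m)) ∧
    -- (ii) mean, variance, characteristic functions
    (MemLp (fun ω => (gap ε 1 ω : ℝ)) 2 P ∧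
      (∫ ω, (gap ε 1 ω : ℝ) ∂P) = 2 ∧
      variance (fun ω => (gap ε 1 ω : ℝ)) P = 2 ∧
      (∀ t : ℝ, HasSum
        (fun m : {m : ℕ // 1 ≤ m} =>
          Complex.exp (2 * Complex.I * Real.pi * (m.val : ℂ) * t) / 2 ^ m.val)
        (∫ ω, Complex.exp (2 * Complex.I * Real.pi * (gap ε 1 ω : ℂ) * t) ∂P)) ∧
      (∀ k : ℕ, 1 ≤ k → ∀ t : ℝ, HasSum
        (fun ν : {ν : ℕ // 1 ≤ ν} =>
          Complex.exp (2 * Complex.I * Real.pi * (ν.val : ℂ) * t) / 2 ^ ν.val *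
            ((ν.val - 1).choose (k - 1) : ℂ))
        (∫ ω, Complex.exp (2 * Complex.I * Real.pi * (jumpTime ε k ω : ℂ) * t) ∂P))) ∧
    -- (iii) law of the jump times
    (∀ k m : ℕ, 1 ≤ k → 1 ≤ m →
      P.real {ω | jumpTime ε k ω = m} = ((m - 1).choose (k - 1) : ℝ) / 2 ^ m ∧
      P.real {ω | jumpTime ε k ω = m} =
        1 / 2 * P.real {ω | bernoulliSum ε (m - 1) ω = k - 1}) ∧
    -- (iv) almost sure growth of the gaps, and law of the iterated logarithm
    ((∀ᵐ ω ∂P,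
        limsup (fun k : ℕ => (((gap ε k ω : ℝ) / Real.logb 2 k : ℝ) : EReal)) atTop = 1) ∧
      (∀ᵐ ω ∂P,
        limsup (fun k : ℕ => ((((jumpTime ε k ω : ℝ) - 2 * k) /
          (2 * √(k * Real.log (Real.log k))) : ℝ) : EReal)) atTop = 1)) ∧
    -- (v) central limit theorem, and local limit theorem with rate
    (TendstoInDistribution
        (fun (k : ℕ) (ω : Ω) => ((jumpTime ε k ω : ℝ) - 2 * k) / √(2 * k)) atTop
        (id : ℝ → ℝ) (fun _ => P) (gaussianReal 0 1) ∧
      ∃ C : ℝ, ∀ k : ℕ, 1 ≤ k → ∀ n : ℤ,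
        |√k * P.real {ω | (jumpTime ε k ω : ℤ) = n} -
          1 / (2 * √Real.pi) * Real.exp (-((n : ℝ) - 2 * k) ^ 2 / (4 * k))| ≤ C / √k) := by
  have hX := hε.isGeometricSeq_gap
  have hJ : ∀ k ω, jumpTime ε k ω = ∑ i ∈ Finset.range k, gap ε (i + 1) ω :=
    jumpTime_eq_sum_range ε
  have hJR : ∀ k ω, (jumpTime ε k ω : ℝ) = ∑ i ∈ Finset.range k, (gap ε (i + 1) ω : ℝ) := by
    intro k ω
    rw [hJ]
    push_cast
    rfl
  have hne : ∀ k : ℕ, 1 ≤ k → (Finset.range k).Nonempty := fun k hk =>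
    Finset.nonempty_range_iff.2 (by omega)
  have hlaw : ∀ k m : ℕ, 1 ≤ k → 1 ≤ m →
      P.real {ω | jumpTime ε k ω = m} = ((m - 1).choose (k - 1) : ℝ) / 2 ^ m := by
    intro k m hk hm
    simp_rw [hJ]
    rw [hX.real_sum_eq (hne k hk), if_neg (by omega), Finset.card_range]
  have hchar : ∀ k : ℕ, 1 ≤ k → ∀ t : ℝ, HasSum
      (fun ν : {ν : ℕ // 1 ≤ ν} =>
        Complex.exp (2 * Complex.I * Real.pi * (ν.val : ℂ) * t) / 2 ^ ν.val *
          ((ν.val - 1).choose (k - 1) : ℂ))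
      (∫ ω, Complex.exp (2 * Complex.I * Real.pi * (jumpTime ε k ω : ℂ) * t) ∂P) := by
    intro k hk t
    have h := hX.hasSum_integral_exp_sum (hne k hk) t
    simp_rw [hJ]
    rwa [Finset.card_range] at h
  refine ⟨hε.ae_nonempty, ⟨hX.indep, fun ℓ hℓ => ?_, fun ℓ m hℓ hm => ?_⟩,
    ⟨hX.memLp_two 0, (hX.integrable_natCast_and_integral 0).2, hX.variance_eq 0, fun t => ?_,
      hchar⟩, fun k m hk hm => ⟨hlaw k m hk hm, ?_⟩, ⟨?_, ?_⟩, ?_, ?_⟩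
  · obtain ⟨ℓ, rfl⟩ := Nat.exists_eq_add_of_le' hℓ
    exact ⟨(hX.measurable ℓ).aemeasurable, (hX.measurable 0).aemeasurable,
      (hX.law ℓ).trans (hX.law 0).symm⟩
  · obtain ⟨ℓ, rfl⟩ := Nat.exists_eq_add_of_le' hℓ
    rw [hX.real_eq ℓ m, if_neg (by omega), one_div_pow]
  · have h := hchar 1 le_rfl t
    simpa [jumpTime] using h
  · rw [hlaw k m hk hm, hε.real_bernoulliSum_eq]
    obtain ⟨m, rfl⟩ := Nat.exists_eq_add_of_le' hm
    rw [Nat.add_sub_cancel, pow_succ]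
    ring
  · filter_upwards [hX.ae_limsup_div_logb] with ω hω
    rw [← hω]
    exact (limsup_nat_add
      (fun k : ℕ => (((gap ε k ω : ℝ) / Real.logb 2 k : ℝ) : EReal)) 1).symm
  · filter_upwards [hX.ae_limsup_sum_eq_one] with ω hω
    simp_rw [hJR]
    exact hω
  · simp_rw [hJR]
    exact hX.tendstoInDistribution_sum
  · obtain ⟨C, -, hC⟩ := IsGeometricSeq.exists_local_limit_bound
    refine ⟨C, fun k hk n => ?_⟩
    have h := hC hX (Finset.range k) (hne k hk) n
    rw [Finset.card_range] at h
    simp_rw [hJ]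
    exact h
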